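/- Definitions. Let $M\in\{0,1\}^{n\times m}$ be a binary matrix and let $\sigma$ be a permutation of its rows. $M$ is \emph{$k$-switch-C1P with respect to $\sigma$} if for every column $j$ there are at most $k$ indices $i\in\{1,\dots,n-1\}$ with $M_{\sigma_i j}\neq M_{\sigma_{i+1} j}$; $M$ is \emph{$k$-switch-C1P} if this holds for some $\sigma$. A preference profile with voters $\{1,\dots,n\}$ over a candidate set $C$ assigns to each voter $v$ a strict linear order $\succ_v$ on $C$. It is \emph{$k$-crossing with respect to} a permutation $\sigma$ of the voters if for every pair of distinct candidates $c,c'$ there are at most $k$ indices $i\in\{1,\dots,n-1\}$ such that exactly one of $c\succ_{\sigma_i}c'$ and $c\succ_{\sigma_{i+1}}c'$ holds; it is \emph{$k$-crossing} if this holds for some $\sigma$. The corresponding recognition problems ask whether a given binary matrix is $k$-switch-C1P, and whether a given preference profile is $k$-crossing (matrices are given by their rows, profiles by the list of the voters' rankings). For a binary matrix $M$ with rows $1,\dots,n$ and columns $1,\dots,m$, let $P_M$ be the profile whose voters are the rows $1,\dots,n$, whose candidates are $c_j^1,c_j^2$ for $1\le j\le m$, and in which, for every voter $i$, $c_{j_1}^{\ell_1}\succ_i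 c_{j_2}^{\ell_2}$ whenever $j_1<j_2$ and $\ell_1,\ell_2\in\{1,2\}$, while $c_j^1\succ_i c_j^2$ if $M_{ij}=1$ and $c_j^2\succ_i c_j^1$ if $M_{ij}=0$. Theorem. (1) Suppose that for every $k\ge 4$ the recognition problem for $k$-switch-C1P matrices is NP-complete. Then for every $k\ge 4$ the recognition problem for $k$-crossing profiles is NP-complete. (2) For every $k\ge 0$, the map $M\mapsto P_M$ is a polynomial-time many-one reduction from the recognition of $k$-switch-C1P matrices to the recognition of $k$-crossing profiles; that is, it is computable in polynomial time, and $M$ is $k$-switch-C1P if and only if $P_M$ is $k$-crossing. (3) Moreover, for every $k\ge 0$, every binary matrix $M$ and every permutation $\sigma$ of its rows, $M$ is $k$-switch-C1P with respect to $\sigma$ if and only if $P_M$ is $k$-crossing with respect to $\sigma$. -/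

import Mathlib

namespace Crossing

/-! ### Decision problems, NP, polynomial-time reductions, NP-completeness

Polynomial-time computability is Mathlib's `Turing.TM2ComputableInPolyTime`: computability by a
multi-stack Turing machine within a number of steps that is polynomial in the length of the
encoded input. -/

/-- A decision problem: a type of instances, written down as words over a finite alphabet, together
with the set of yes-instances. -/
structure DecisionProblem where
  /-- the instances -/
  Inst : Type
  /-- the alphabet in which the instances are written -/
  Letter : Type
  [finLetter : Fintype Letter]
  /-- the word that describes an instance -/
  encode : Inst → List Letter
  encode_injective : Function.Injective encode
  /-- the yes-instances -/
  Yes : Inst → Prop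

/-- The membership problem of a language over a finite alphabet. -/
def ofLanguage {A : Type} [Fintype A] (L : Language A) : DecisionProblem where
  Inst := List A
  Letter := A
  encode := id
  encode_injective := Function.injective_id
  Yes := fun w => w ∈ L

/-- The word that describes an instance together with a certificate (a binary word): the two words
are written one after the other, in disjoint alphabets. -/
def encodeWithCertificate (Q : DecisionProblem) (x : Q.Inst × List Bool) :
    List (Q.Letter ⊕ Bool) :=
  (Q.encode x.1).map Sum.inl ++ x.2.map Sum.inr

/-- `Q` is in NP: there are a polynomial `p` and a polynomial-time verifier `R` such that `a` is a
yes-instance iff `R` accepts `a` with some certificate of length at most `p |a|`. -/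
def InNP (Q : DecisionProblem) : Prop :=
  ∃ (p : Polynomial ℕ) (R : Q.Inst × List Bool → Bool),
    Nonempty (Turing.TM2ComputableInPolyTime (encodeWithCertificate Q) Computability.encodeBool R) ∧
    ∀ a : Q.Inst, Q.Yes a ↔
      ∃ w : List Bool, w.length ≤ p.eval (Q.encode a).length ∧ R (a, w) = true

/-- `f` is a polynomial-time many-one (Karp) reduction from `Q` to `Q'`. -/
def IsPolyTimeReduction (Q Q' : DecisionProblem) (f : Q.Inst → Q'.Inst) : Prop :=
  Nonempty (Turing.TM2ComputableInPolyTime Q.encode Q'.encode f) ∧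
    ∀ a : Q.Inst, Q.Yes a ↔ Q'.Yes (f a)

/-- `Q` is NP-hard: every language in NP reduces to `Q` in polynomial time. -/
def NPHard (Q : DecisionProblem) : Prop :=
  ∀ (A : Type) [Fintype A] (L : Language A), InNP (ofLanguage L) →
    ∃ f : List A → Q.Inst, IsPolyTimeReduction (ofLanguage L) Q f

/-- `Q` is NP-complete. -/
def NPComplete (Q : DecisionProblem) : Prop :=
  InNP Q ∧ NPHard Q

/-! ### Preference profiles, crossings and switches -/

/-- A preference profile with voters `V` and candidates `C`: each voter `v` has a strict linear
order on the candidates; `pref v c c'` says that `v` prefers `c` to `c'`. -/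
@[ext]
structure Profile (V C : Type) where
  /-- the preference relation of each voter -/
  pref : V → C → C → Prop
  strictTotal : ∀ v, IsStrictTotalOrder C (pref v)

/-- Renaming the candidates of a profile. -/
def Profile.relabel {V C D : Type} (e : C ≃ D) (P : Profile V C) : Profile V D where
  pref := fun v d d' => P.pref v (e.symm d) (e.symm d')
  strictTotal := fun v => by
    have := P.strictTotal v
    exact (RelEmbedding.preimage e.symm.toEmbedding (P.pref v)).isStrictTotalOrder

/-- The number of positions `i` at which consecutive values `f i`, `f (i + 1)` of a sequence of
length `n` differ. -/
noncomputable def numChanges {n : ℕ} {α : Type} (f : Fin n → α) : ℕ :=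
  {i : Fin n | ∃ h : (i : ℕ) + 1 < n, f i ≠ f ⟨(i : ℕ) + 1, h⟩}.ncard

/-- `P` is `k`-crossing with respect to the order `σ 0, σ 1, …` of the voters. -/
def IsCrossingWrt (k : ℕ) {n : ℕ} {C : Type} (P : Profile (Fin n) C)
    (σ : Equiv.Perm (Fin n)) : Prop :=
  ∀ c c' : C, c ≠ c' → numChanges (fun i => P.pref (σ i) c c') ≤ k

/-- `P` is `k`-crossing. -/
def IsCrossing (k : ℕ) {n : ℕ} {C : Type} (P : Profile (Fin n) C) : Prop :=
  ∃ σ : Equiv.Perm (Fin n), IsCrossingWrt k P σ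

/-- The binary matrix `M` has at most `k` switches in each column when its rows are put into the
order `σ 0, σ 1, …`. -/
def IsSwitchC1PWrt (k : ℕ) {n m : ℕ} (M : Matrix (Fin n) (Fin m) Bool)
    (σ : Equiv.Perm (Fin n)) : Prop :=
  ∀ j : Fin m, numChanges (fun i => M (σ i) j) ≤ k

/-- `M` has the `k`-switch consecutive-ones property. -/
def IsSwitchC1P (k : ℕ) {n m : ℕ} (M : Matrix (Fin n) (Fin m) Bool) : Prop :=
  ∃ σ : Equiv.Perm (Fin n), IsSwitchC1PWrt k M σ

/-! ### Words that describe matrices and profiles -/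

/-- Lines of bits written one after the other, each ended by the symbol `none`. -/
def encodeLines (l : List (List Bool)) : List (Option Bool) :=
  l.flatMap fun b => b.map some ++ [none]

/-- Natural numbers in unary, each ended by `false`. -/
def encodeNats (l : List ℕ) : List Bool :=
  l.flatMap fun c => List.replicate c true ++ [false]

theorem encodeLines_injective : Function.Injective encodeLines := by
  have key : ∀ (a b : List Bool) (s t : List (Option Bool)),
      a.map some ++ none :: s = b.map some ++ none :: t → a = b ∧ s = t := by
    intro a
    induction a with
    | nil => intro b s t h; cases b <;> simp_all
    | cons x a ih =>
      intro b s t h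
      cases b with
      | nil => simp at h
      | cons y b =>
        simp only [List.map_cons, List.cons_append, List.cons.injEq, Option.some.injEq] at h
        obtain ⟨h1, h2⟩ := ih b s t h.2
        exact ⟨by rw [h.1, h1], h2⟩
  intro l
  induction l with
  | nil => intro l' h; cases l' <;> simp_all [encodeLines]
  | cons a l ih =>
    intro l' h
    cases l' with
    | nil => simp [encodeLines] at h
    | cons b l' =>
      simp only [encodeLines, List.flatMap_cons, List.append_assoc, List.singleton_append] at h
      obtain ⟨h1, h2⟩ := key _ _ _ _ h
      rw [h1, ih h2]

theorem encodeNats_injective : Function.Injective encodeNats := by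
  have key : ∀ (a b : ℕ) (s t : List Bool),
      List.replicate a true ++ false :: s = List.replicate b true ++ false :: t →
        a = b ∧ s = t := by
    intro a
    induction a with
    | zero => intro b s t h; cases b <;> simp_all [List.replicate_succ]
    | succ a ih =>
      intro b s t h
      cases b with
      | zero => simp [List.replicate_succ] at h
      | succ b =>
        simp only [List.replicate_succ, List.cons_append, List.cons.injEq, true_and] at h
        obtain ⟨h1, h2⟩ := ih b s t h
        exact ⟨by rw [h1], h2⟩
  intro l
  induction l with
  | nil => intro l' h; cases l' <;> simp_all [encodeNats]
  | cons a l ih =>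
    intro l' h
    cases l' with
    | nil => simp [encodeNats] at h
    | cons b l' =>
      simp only [encodeNats, List.flatMap_cons, List.append_assoc, List.singleton_append] at h
      obtain ⟨h1, h2⟩ := key _ _ _ _ h
      rw [h1, ih h2]

/-- The word of a binary matrix: a first line that gives the number of columns in unary, then the
rows, one per line. -/
def encodeMatrix (x : (n : ℕ) × (m : ℕ) × Matrix (Fin n) (Fin m) Bool) : List (Option Bool) :=
  encodeLines (List.replicate x.2.1 true ::
    List.ofFn fun i : Fin x.1 => List.ofFn fun j : Fin x.2.1 => x.2.2 i j)

theorem encodeMatrix_injective : Function.Injective encodeMatrix := by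
  rintro ⟨n, m, M⟩ ⟨n', m', M'⟩ h
  have h := encodeLines_injective h
  simp only [List.cons.injEq] at h
  obtain ⟨hm, h⟩ := h
  have hm : m = m' := by simpa using congrArg List.length hm
  have hn : n = n' := by simpa using congrArg List.length h
  subst hm hn
  have h := List.ofFn_injective h
  have : M = M' := by
    funext i j
    exact congrFun (List.ofFn_injective (congrFun h i)) j
  rw [this]

open scoped Classical in
/-- The candidates in decreasing order of preference of the voter `v`. -/
noncomputable def Profile.ranking {V : Type} {m : ℕ} (P : Profile V (Fin m)) (v : V) :
    List (Fin m) :=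
  (List.finRange m).insertionSort fun c c' => c = c' ∨ P.pref v c c'

open scoped Classical in
theorem Profile.ranking_perm {V : Type} {m : ℕ} (P : Profile V (Fin m)) (v : V) :
    (P.ranking v).Perm (List.finRange m) :=
  List.perm_insertionSort _ _

theorem Profile.ranking_pairwise {V : Type} {m : ℕ} (P : Profile V (Fin m)) (v : V) :
    (P.ranking v).Pairwise (P.pref v) := by
  classical
  have := P.strictTotal v
  have htot : Std.Total (fun c c' : Fin m => c = c' ∨ P.pref v c c') :=
    ⟨fun a b => by
      rcases trichotomous_of (P.pref v) a b with h | h | h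
      · exact Or.inl (Or.inr h)
      · exact Or.inl (Or.inl h)
      · exact Or.inr (Or.inr h)⟩
  have htr : IsTrans (Fin m) (fun c c' : Fin m => c = c' ∨ P.pref v c c') :=
    ⟨fun a b c h h' => by
      rcases h with rfl | h
      · exact h'
      · rcases h' with rfl | h'
        · exact Or.inr h
        · exact Or.inr (_root_.trans h h')⟩
  have h1 : (P.ranking v).Pairwise fun c c' => c = c' ∨ P.pref v c c' :=
    List.pairwise_insertionSort _ _
  have h2 : (P.ranking v).Nodup := (P.ranking_perm v).nodup_iff.2 (List.nodup_finRange m)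
  exact (h1.and h2).imp fun {a b} h => h.1.resolve_left h.2

theorem Profile.ranking_injective {V : Type} {m : ℕ} (P Q : Profile V (Fin m))
    (h : ∀ v, P.ranking v = Q.ranking v) : P = Q := by
  have key : ∀ (P Q : Profile V (Fin m)) (v : V), P.ranking v = Q.ranking v →
      ∀ c c', P.pref v c c' → Q.pref v c c' := by
    intro P Q v h c c' hc
    have := P.strictTotal v
    have := Q.strictTotal v
    by_contra hq
    have hne : c ≠ c' := by rintro rfl; exact irrefl _ hc
    have hp1 := P.ranking_pairwise v
    have hq1 := Q.ranking_pairwise v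
    rw [← h] at hq1
    have hboth := hp1.and hq1
    have hmem : ∀ d, d ∈ P.ranking v := fun d =>
      (P.ranking_perm v).mem_iff.2 (List.mem_finRange d)
    have hs : (P.ranking v).Pairwise fun a b =>
        (P.pref v a b ∧ Q.pref v a b) ∨ (P.pref v b a ∧ Q.pref v b a) :=
      hboth.imp fun h => Or.inl h
    have hsym : Std.Symm fun a b : Fin m =>
        (P.pref v a b ∧ Q.pref v a b) ∨ (P.pref v b a ∧ Q.pref v b a) :=
      ⟨fun a b h => h.symm⟩
    rcases hs.forall (hmem c) (hmem c') hne with h | h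
    · exact hq h.2
    · exact asymm_of (P.pref v) hc h.1
  ext v c c'
  exact ⟨key P Q v (h v) c c', key Q P v (h v).symm c c'⟩

/-- The word of a profile: a first line that gives the number of candidates in unary, then one line
per voter, which lists the (unary) names of the candidates in decreasing order of preference. -/
noncomputable def encodeProfile (x : (n : ℕ) × (m : ℕ) × Profile (Fin n) (Fin m)) :
    List (Option Bool) :=
  encodeLines (List.replicate x.2.1 true ::
    List.ofFn fun v : Fin x.1 => encodeNats ((x.2.2.ranking v).map Fin.val))

theorem encodeProfile_injective : Function.Injective encodeProfile := by
  rintro ⟨n, m, P⟩ ⟨n', m', P'⟩ h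
  have h := encodeLines_injective h
  simp only [List.cons.injEq] at h
  obtain ⟨hm, h⟩ := h
  have hm : m = m' := by simpa using congrArg List.length hm
  have hn : n = n' := by simpa using congrArg List.length h
  subst hm hn
  have h := List.ofFn_injective h
  have : P = P' := P.ranking_injective P' fun v =>
    List.map_injective_iff.2 Fin.val_injective (encodeNats_injective (congrFun h v))
  rw [this]

/-! ### The two recognition problems and the profile of a matrix -/

/-- Given a binary matrix, is it `k`-switch-C1P? -/
def switchC1PRec (k : ℕ) : DecisionProblem where
  Inst := (n : ℕ) × (m : ℕ) × Matrix (Fin n) (Fin m) Bool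
  Letter := Option Bool
  encode := encodeMatrix
  encode_injective := encodeMatrix_injective
  Yes := fun x => IsSwitchC1P k x.2.2

/-- Given a preference profile, is it `k`-crossing? -/
noncomputable def crossingRec (k : ℕ) : DecisionProblem where
  Inst := (n : ℕ) × (m : ℕ) × Profile (Fin n) (Fin m)
  Letter := Option Bool
  encode := encodeProfile
  encode_injective := encodeProfile_injective
  Yes := fun x => IsCrossing k x.2.2

/-- The conjecture: recognizing `k`-switch-C1P matrices is NP-complete for every `k ≥ 4`. -/
def SwitchC1PConjecture : Prop :=
  ∀ k : ℕ, 4 ≤ k → NPComplete (switchC1PRec k)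

/-- The profile `P_M` of a binary matrix `M`. The voters are the rows; column `j` has the two
candidates `(j, 0)` and `(j, 1)`. Candidates of different columns are ranked by the column, and
voter `i` prefers `(j, 0)` to `(j, 1)` iff `M i j` is one. -/
def matrixProfile {n m : ℕ} (M : Matrix (Fin n) (Fin m) Bool) :
    Profile (Fin n) (Fin m × Fin 2) where
  pref := fun i c c' =>
    c.1 < c'.1 ∨ (c.1 = c'.1 ∧ ((M i c.1 = true ∧ c.2 = 0 ∧ c'.2 = 1) ∨
      (M i c.1 = false ∧ c.2 = 1 ∧ c'.2 = 0)))
  strictTotal := fun i =>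
    { trichotomous := by
        rintro ⟨a, x⟩ ⟨b, y⟩ h h'
        fin_cases x <;> fin_cases y <;> cases hM : M i a <;> simp_all <;> grind
      irrefl := by
        rintro ⟨a, x⟩
        fin_cases x <;> simp
      trans := by
        rintro ⟨a, x⟩ ⟨b, y⟩ ⟨c, z⟩ h h'
        simp only at h h' ⊢
        grind }

/-- The map `M ↦ P_M` on instances, with the candidates numbered
`(0, 0), (0, 1), (1, 0), (1, 1), …`. -/
def matrixToProfile (x : (n : ℕ) × (m : ℕ) × Matrix (Fin n) (Fin m) Bool) :
    (n : ℕ) × (m : ℕ) × Profile (Fin n) (Fin m) :=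
  ⟨x.1, x.2.1 * 2, (matrixProfile x.2.2).relabel finProdFinEquiv⟩

end Crossing

/-! In `P_M`, candidates of different columns are ranked alike by all voters and never cross. The
two candidates of column `j` are ranked by voter `i` according to the entry `M i j`, so along any
order of the rows the crossings of this pair are exactly the switches of the column. Hence the
equivalence holds for each order separately (`isSwitchC1PWrt_iff`), and therefore also after
quantifying over the orders.

NP-hardness passes from matrices to profiles along this map. NP-membership is pulled back along a
reduction in the opposite direction: a profile is sent to its comparison matrix, which has one
column for each ordered pair of candidates and the entry one where the voter prefers the first to
the second (`profileToMatrix`). Its off-diagonal columns record the crossings and its diagonal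
columns are constant, so the profile is `k`-crossing iff this matrix is `k`-switch-C1P
(`isCrossing_iff`). Membership of the matrix problem in NP is part of the assumed NP-completeness,
and NP is closed under reductions (`InNP.of_reduction`).

The bulk of the work is polynomial time on multi-stack machines. Programs are assembled from blocks
that start and end in the default internal state, with an explicit step bound for every run. Three
facts are derived: polynomial-time functions compose (`computable_comp`), since a machine cannot
write more than its running time allows; a reduction can be run while a certificate is kept aside,
and the certificate cut to an admissible length (`computable_withCertificate`,
`computable_truncate`), which gives the closure of NP; and both translations are computed by
explicit programs (`computable_matrixToProfile`, `computable_profileToMatrix`). -/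

open Turing

/-! ### Composable stack programs with step bounds. -/

namespace StackMachine

/-! ### Bounded reachability -/

/-- The step function `f` leads from `a` to `b` in at most `t` steps. -/
def ReachesWithin {α : Type*} (f : α → Option α) (t : ℕ) (a b : α) : Prop :=
  ∃ n ≤ t, (flip bind f)^[n] (some a) = some b

namespace ReachesWithin

variable {α β : Type*} {f : α → Option α} {g : β → Option β} {s t : ℕ} {a b c : α}

theorem refl (f : α → Option α) (a : α) : ReachesWithin f 0 a a :=
  ⟨0, le_rfl, rfl⟩

theorem mono (h : ReachesWithin f s a b) (hst : s ≤ t) : ReachesWithin f t a b :=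
  h.imp fun _ h => ⟨h.1.trans hst, h.2⟩

theorem trans (h₁ : ReachesWithin f s a b) (h₂ : ReachesWithin f t b c) :
    ReachesWithin f (s + t) a c := by
  obtain ⟨n, hn, h₁⟩ := h₁
  obtain ⟨k, hk, h₂⟩ := h₂
  exact ⟨k + n, by omega, by rw [Function.iterate_add_apply, h₁, h₂]⟩

theorem head (h₁ : f a = some b) (h₂ : ReachesWithin f t b c) : ReachesWithin f (t + 1) a c := by
  obtain ⟨k, hk, h₂⟩ := h₂
  exact ⟨k + 1, by omega, by simpa [flip, h₁] using h₂⟩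

/-- Only successful steps of `f` have to be matched. Where `f` halts, `g` is free to continue, and
this is what allows a finished subprogram to hand over control. -/
theorem map (F : α → β) (hF : ∀ a b, f a = some b → g (F a) = some (F b))
    (h : ReachesWithin f t a b) : ReachesWithin g t (F a) (F b) := by
  obtain ⟨n, hn, h⟩ := h
  refine ⟨n, hn, ?_⟩
  clear hn
  induction n generalizing a with
  | zero => simp_all
  | succ n ih =>
    rw [Function.iterate_succ_apply] at h ⊢
    cases ha : f a with
    | none =>
      have hnone : (flip bind f)^[n] none = none := Function.iterate_fixed rfl n
      rw [show flip bind f (some a) = none from ha, hnone] at h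
      cases h
    | some a' =>
      simp only [flip, Option.bind_eq_bind, Option.bind_some, ha] at h
      simpa [flip, hF a a' ha] using ih h

end ReachesWithin

/-! ### Programs that manipulate stacks -/

/-- A piece of a stack program. Control enters at `entry` and leaves by `halt`. -/
structure Block (K : Type) (Γ : K → Type) (σ : Type) where
  /-- the labels -/
  Label : Type
  [finLabel : Fintype Label]
  /-- the label at which control enters -/
  entry : Label
  /-- the code at each label -/
  code : Label → TM2.Stmt Γ Label σ

attribute [instance] Block.finLabel

/-- Internal states that can hold a symbol of `α`, or the information that there is none. -/
class Reg (σ α : Type) where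
  /-- the state that holds a given symbol -/
  store : Option α → σ
  /-- the symbol that is held -/
  read : σ → Option α
  read_store : ∀ x, read (store x) = x

instance (α : Type) : Reg (Option α) α := ⟨id, id, fun _ => rfl⟩

/-- Hold the symbols of `α` under the names that they have in `β`. -/
@[reducible] def Reg.ofEquiv {σ α β : Type} [Reg σ β] (e : α ≃ β) : Reg σ α :=
  ⟨fun x => Reg.store (x.map e), fun s => (Reg.read s).map e.symm,
    fun x => by rw [Reg.read_store]; cases x <;> simp⟩

section

variable {K : Type} {Γ : K → Type} {σ Λ Λ' : Type}

/-- Rename the labels of a statement, and jump to the label `e` (if any) instead of halting. -/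
def relink (f : Λ → Λ') (e : Option Λ') : TM2.Stmt Γ Λ σ → TM2.Stmt Γ Λ' σ
  | .push k g q => .push k g (relink f e q)
  | .peek k g q => .peek k g (relink f e q)
  | .pop k g q => .pop k g (relink f e q)
  | .load g q => .load g (relink f e q)
  | .branch p q₁ q₂ => .branch p (relink f e q₁) (relink f e q₂)
  | .goto l => .goto fun s => f (l s)
  | .halt => e.elim .halt fun l => .goto fun _ => l

namespace Block

/-- The program that does nothing. -/
def skip : Block K Γ σ where
  Label := Unit
  entry := ()
  code _ := .halt

/-- Push a symbol. -/
def push (k : K) (x : Γ k) : Block K Γ σ where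
  Label := Unit
  entry := ()
  code _ := .push k (fun _ => x) .halt

/-- Execute two programs one after the other. -/
def seq (B₁ B₂ : Block K Γ σ) : Block K Γ σ where
  Label := B₁.Label ⊕ B₂.Label
  entry := Sum.inl B₁.entry
  code := Sum.elim (fun l => relink Sum.inl (some (Sum.inr B₂.entry)) (B₁.code l))
    (fun l => relink Sum.inr none (B₂.code l))

/-- Pop a symbol `x` from the stack `k` (`x = none` if the stack is empty), execute `B x`, and
start again if `again x`. -/
def popLoop [Inhabited σ] (k : K) [Fintype (Γ k)] [Reg σ (Γ k)] (again : Option (Γ k) → Bool)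
    (B : Option (Γ k) → Block K Γ σ) : Block K Γ σ where
  Label := Option (Σ x : Option (Γ k), Option (B x).Label)
  entry := none
  code
    | none => .pop k (fun _ x => Reg.store x) (.goto fun s => some ⟨Reg.read s, none⟩)
    | some ⟨x, none⟩ => .load (fun _ => default) (.goto fun _ => some ⟨x, some (B x).entry⟩)
    | some ⟨x, some l⟩ =>
      relink (fun l => some ⟨x, some l⟩) (bif again x then some none else none) ((B x).code l)

/-- Pop symbols `x` from the stack `k` and execute `B x` until the stack is empty. -/
def forEach [Inhabited σ] (k : K) [Fintype (Γ k)] [Reg σ (Γ k)] (B : Γ k → Block K Γ σ) :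
    Block K Γ σ :=
  popLoop k Option.isSome fun x => x.elim skip B

/-- Pop a symbol `x` from the stack `k` (`x = none` if the stack is empty) and execute `B x`. -/
def popCase [Inhabited σ] (k : K) [Fintype (Γ k)] [Reg σ (Γ k)]
    (B : Option (Γ k) → Block K Γ σ) : Block K Γ σ :=
  popLoop k (fun _ => false) B

end Block

variable [DecidableEq K]

theorem stepAux_relink (f : Λ → Λ') (e : Option Λ') (q : TM2.Stmt Γ Λ σ) (v : σ)
    (S : ∀ k, List (Γ k)) :
    TM2.stepAux (relink f e q) v S =
      ⟨(TM2.stepAux q v S).l.elim e fun l => some (f l), (TM2.stepAux q v S).var,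
        (TM2.stepAux q v S).stk⟩ := by
  induction q generalizing v S with
  | branch p q₁ q₂ ih₁ ih₂ => cases h : p v <;> simp [relink, ih₁, ih₂, h]
  | halt => cases e <;> simp [relink]
  | _ => simp_all [relink]

/-- The jump to the exit label `e` takes the place of `halt` inside the same step, so linking
programs costs no extra time. -/
theorem reachesWithin_relink {m : Λ → TM2.Stmt Γ Λ σ} {m' : Λ' → TM2.Stmt Γ Λ' σ} (f : Λ → Λ')
    (e : Option Λ') (hm : ∀ l, m' (f l) = relink f e (m l)) {t : ℕ} {l : Λ} {v v' : σ}
    {S S' : ∀ k, List (Γ k)} (h : ReachesWithin (TM2.step m) t ⟨some l, v, S⟩ ⟨none, v', S'⟩) :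
    ReachesWithin (TM2.step m') t ⟨some (f l), v, S⟩ ⟨e, v', S'⟩ := by
  refine ReachesWithin.map (fun c : TM2.Cfg Γ Λ σ =>
    (⟨c.l.elim e fun l => some (f l), c.var, c.stk⟩ : TM2.Cfg Γ Λ' σ)) ?_ h
  rintro ⟨_ | l, v, S⟩ c hc
  · simp at hc
  · simp only [TM2.step, Option.some.injEq] at hc
    subst hc
    simp [TM2.step, hm, stepAux_relink]

namespace Block

variable [Inhabited σ] {B B₁ B₂ : Block K Γ σ} {S S₁ S₂ S₃ : ∀ k, List (Γ k)} {t t₁ t₂ : ℕ}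

/-- `B` changes the stacks from `S` to `S'` within `t` steps. -/
def Runs (B : Block K Γ σ) (S S' : ∀ k, List (Γ k)) (t : ℕ) : Prop :=
  ReachesWithin (TM2.step B.code) t ⟨some B.entry, default, S⟩ ⟨none, default, S'⟩

theorem Runs.mono (h : B.Runs S S₁ t₁) (ht : t₁ ≤ t₂) : B.Runs S S₁ t₂ :=
  ReachesWithin.mono h ht

theorem Runs.congr {S' S₁' : ∀ k, List (Γ k)} (h : B.Runs S S₁ t₁) (hS : S = S') (hS₁ : S₁ = S₁')
    (ht : t₁ ≤ t₂) : B.Runs S' S₁' t₂ := by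
  subst hS hS₁
  exact h.mono ht

theorem runs_skip (S : ∀ k, List (Γ k)) : (skip : Block K Γ σ).Runs S S 1 :=
  ReachesWithin.head (b := ⟨none, default, S⟩) rfl (.refl _ _)

theorem runs_push (k : K) (x : Γ k) (S : ∀ k, List (Γ k)) :
    (push k x : Block K Γ σ).Runs S (Function.update S k (x :: S k)) 1 :=
  ReachesWithin.head (b := ⟨none, default, _⟩) rfl (.refl _ _)

theorem Runs.seq (h₁ : B₁.Runs S₁ S₂ t₁) (h₂ : B₂.Runs S₂ S₃ t₂) :
    (B₁.seq B₂).Runs S₁ S₃ (t₁ + t₂) :=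
  (reachesWithin_relink Sum.inl _ (fun _ => rfl) h₁).trans
    (reachesWithin_relink Sum.inr none (fun _ => rfl) h₂)

section Loops

variable {k : K} [Fintype (Γ k)] [Reg σ (Γ k)] {again : Option (Γ k) → Bool}

/-- Two steps precede the body: the pop, which stores the symbol in the internal state and jumps to
the label belonging to it, and the reset of the state to `default`, where `Runs` requires a body to
start. -/
theorem reachesWithin_popLoop {B : Option (Γ k) → Block K Γ σ}
    (h : (B (S k).head?).Runs (Function.update S k (S k).tail) S₁ t) :
    ReachesWithin (TM2.step (popLoop k again B).code) (t + 2)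
      ⟨some (popLoop k again B).entry, default, S⟩
      ⟨bif again (S k).head? then some none else none, default, S₁⟩ := by
  refine .head (b := ⟨some (some ⟨(S k).head?, none⟩), Reg.store (S k).head?,
    Function.update S k (S k).tail⟩) ?_ <| .head rfl <|
    reachesWithin_relink (fun l => some ⟨(S k).head?, some l⟩) _ (fun l => rfl) h
  have hread : (⟨Reg.read (Reg.store (σ := σ) (S k).head?), none⟩ :
      Σ x : Option (Γ k), Option (B x).Label) = ⟨(S k).head?, none⟩ := by rw [Reg.read_store]
  simp only [popLoop, TM2.step, TM2.stepAux, hread]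

theorem Runs.popLoop_exit_nil {B : Option (Γ k) → Block K Γ σ} (hS : S k = [])
    (ha : again none = false) (h : (B none).Runs S S₁ t) :
    (popLoop k again B).Runs S S₁ (t + 2) := by
  have h' : Function.update S k [] = S := by rw [← hS, Function.update_eq_self]
  simpa [hS, ha, Runs] using reachesWithin_popLoop (again := again) (B := B) (S := S) (k := k)
    (S₁ := S₁) (t := t) (by simpa [hS, h'] using h)

theorem Runs.popLoop_exit {B : Option (Γ k) → Block K Γ σ} {x : Γ k} {l : List (Γ k)}
    (hS : S k = x :: l) (ha : again (some x) = false)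
    (h : (B (some x)).Runs (Function.update S k l) S₁ t) :
    (popLoop k again B).Runs S S₁ (t + 2) := by
  simpa [hS, ha, Runs] using reachesWithin_popLoop (again := again) (B := B) (S := S) (k := k)
    (S₁ := S₁) (t := t) (by simpa [hS] using h)

theorem Runs.popLoop_again {B : Option (Γ k) → Block K Γ σ} {x : Γ k} {l : List (Γ k)}
    (hS : S k = x :: l) (ha : again (some x) = true)
    (h : (B (some x)).Runs (Function.update S k l) S₁ t₁)
    (h₂ : (popLoop k again B).Runs S₁ S₂ t₂) :
    (popLoop k again B).Runs S S₂ (t₁ + 2 + t₂) := by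
  have := reachesWithin_popLoop (again := again) (B := B) (S := S) (k := k)
    (S₁ := S₁) (t := t₁) (by simpa [hS] using h)
  simp only [hS, List.head?_cons, ha, cond_true] at this
  exact this.trans h₂

theorem Runs.popCase_nil {B : Option (Γ k) → Block K Γ σ} (hS : S k = [])
    (h : (B none).Runs S S₁ t) : (popCase k B).Runs S S₁ (t + 2) :=
  h.popLoop_exit_nil hS rfl

theorem Runs.popCase_cons {B : Option (Γ k) → Block K Γ σ} {x : Γ k} {l : List (Γ k)}
    (hS : S k = x :: l) (h : (B (some x)).Runs (Function.update S k l) S₁ t) :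
    (popCase k B).Runs S S₁ (t + 2) :=
  h.popLoop_exit hS rfl

theorem runs_forEach_nil (B : Γ k → Block K Γ σ) (hS : S k = []) : (forEach k B).Runs S S 3 :=
  (runs_skip S).popLoop_exit_nil hS rfl

theorem Runs.forEach_cons {B : Γ k → Block K Γ σ} {x : Γ k} {l : List (Γ k)} (hS : S k = x :: l)
    (h : (B x).Runs (Function.update S k l) S₁ t₁) (h₂ : (forEach k B).Runs S₁ S₂ t₂) :
    (forEach k B).Runs S S₂ (t₁ + 2 + t₂) :=
  h.popLoop_again hS rfl h₂

end Loops

end Block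

end

/-! ### Running a program on some of the stacks of a larger machine -/

section Lift

variable {K₁ K : Type} {Γ : K → Type} {σ₁ σ Λ : Type}

/-- A statement that uses only the stacks `e k` and a part of the internal state. -/
def liftStmt (e : K₁ → K) (get : σ → σ₁) (upd : σ → σ₁ → σ) :
    TM2.Stmt (fun k => Γ (e k)) Λ σ₁ → TM2.Stmt Γ Λ σ
  | .push k g q => .push (e k) (fun s => g (get s)) (liftStmt e get upd q)
  | .peek k g q => .peek (e k) (fun s x => upd s (g (get s) x)) (liftStmt e get upd q)
  | .pop k g q => .pop (e k) (fun s x => upd s (g (get s) x)) (liftStmt e get upd q)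
  | .load g q => .load (fun s => upd s (g (get s))) (liftStmt e get upd q)
  | .branch p q₁ q₂ =>
    .branch (fun s => p (get s)) (liftStmt e get upd q₁) (liftStmt e get upd q₂)
  | .goto l => .goto fun s => l (get s)
  | .halt => .halt

/-- A program that uses only the stacks `e k` and a part of the internal state. -/
def Block.lift (e : K₁ → K) (get : σ → σ₁) (upd : σ → σ₁ → σ)
    (B : Block K₁ (fun k => Γ (e k)) σ₁) : Block K Γ σ where
  Label := B.Label
  entry := B.entry
  code l := liftStmt e get upd (B.code l)

variable [DecidableEq K₁] [DecidableEq K] {e : K₁ → K} {get : σ → σ₁} {upd : σ → σ₁ → σ}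
  {put : σ₁ → σ} {J : (∀ k, List (Γ (e k))) → ∀ k, List (Γ k)}

/-- `put` and `J` embed the states and stacks of the small machine into those of the large one, with
everything else frozen. The hypotheses say that reading and writing commute with these embeddings.
-/
theorem stepAux_liftStmt (hget : ∀ v, get (put v) = v) (hupd : ∀ v v', upd (put v) v' = put v')
    (hJ : ∀ T k, J T (e k) = T k)
    (hJ' : ∀ T k x, Function.update (J T) (e k) x = J (Function.update T k x))
    (q : TM2.Stmt (fun k => Γ (e k)) Λ σ₁) (v : σ₁) (T : ∀ k, List (Γ (e k))) :
    TM2.stepAux (liftStmt e get upd q) (put v) (J T) =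
      ⟨(TM2.stepAux q v T).l, put (TM2.stepAux q v T).var, J (TM2.stepAux q v T).stk⟩ := by
  induction q generalizing v T with
  | branch p q₁ q₂ ih₁ ih₂ => cases h : p v <;> simp [liftStmt, ih₁, ih₂, h, hget]
  | _ => simp_all [liftStmt]

theorem Block.Runs.lift [Inhabited σ₁] [Inhabited σ] {B : Block K₁ (fun k => Γ (e k)) σ₁}
    {S S' : ∀ k, List (Γ (e k))} {t : ℕ} (h : B.Runs S S' t)
    (hget : ∀ v, get (put v) = v) (hupd : ∀ v v', upd (put v) v' = put v')
    (hput : put default = default) (hJ : ∀ T k, J T (e k) = T k)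
    (hJ' : ∀ T k x, Function.update (J T) (e k) x = J (Function.update T k x)) :
    (B.lift e get upd).Runs (J S) (J S') t := by
  have := ReachesWithin.map (g := TM2.step (B.lift e get upd).code)
    (fun c : TM2.Cfg (fun k => Γ (e k)) B.Label σ₁ =>
      (⟨c.l, put c.var, J c.stk⟩ : TM2.Cfg Γ B.Label σ)) ?_ h
  · simp only [hput] at this
    exact this
  · rintro ⟨_ | l, v, S⟩ c hc
    · simp at hc
    · simp only [TM2.step, Option.some.injEq] at hc
      subst hc
      simp only [TM2.step, Block.lift, stepAux_liftStmt hget hupd hJ hJ']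

end Lift

end StackMachine

/-! ### Machines as programs, length of outputs, and composition of polynomial-time functions. -/

open Turing

namespace StackMachine

/-! ### Programs and machines -/

section

variable {K : Type} [DecidableEq K] {Γ : K → Type} {σ : Type}

/-- All stacks but one are empty. -/
def single (k : K) (l : List (Γ k)) : ∀ k, List (Γ k) :=
  Function.update (fun _ => []) k l

theorem initList_eq (tm : FinTM2) (l : List (tm.Γ tm.k₀)) :
    initList tm l = ⟨some tm.main, tm.initialState, single tm.k₀ l⟩ := by
  refine congrArg (TM2.Cfg.mk (some tm.main) tm.initialState) (funext fun k => ?_)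
  by_cases h : k = tm.k₀
  · subst h; simp [single]
  · simp [single, h]

theorem haltList_eq (tm : FinTM2) (l : List (tm.Γ tm.k₁)) :
    haltList tm l = ⟨none, tm.initialState, single tm.k₁ l⟩ := by
  refine congrArg (TM2.Cfg.mk none tm.initialState) (funext fun k => ?_)
  by_cases h : k = tm.k₁
  · subst h; simp [single]
  · simp [single, h]

variable {α β αΓ βΓ : Type} {ea : α → List αΓ} {eb : β → List βΓ} {f : α → β}

theorem computable_of_runs [Fintype K] [Fintype σ] [Inhabited σ] (B : Block K Γ σ) {k₀ k₁ : K}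
    [Fintype (Γ k₀)] (φ : Γ k₀ ≃ αΓ) (ψ : Γ k₁ ≃ βΓ) (p : Polynomial ℕ)
    (h : ∀ a, B.Runs (single k₀ ((ea a).map φ.symm)) (single k₁ ((eb (f a)).map ψ.symm))
      (p.eval (ea a).length)) :
    Nonempty (TM2ComputableInPolyTime ea eb f) := by
  refine ⟨{
    tm := {
      K := K
      k₀ := k₀
      k₁ := k₁
      Γ := Γ
      Λ := B.Label
      main := B.entry
      σ := σ
      initialState := default
      m := B.code }
    inputAlphabet := φ
    outputAlphabet := ψ
    time := p
    outputsFun := fun a => ?_ }⟩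
  refine ⟨⟨(h a).choose, ?_⟩, (h a).choose_spec.1⟩
  rw [Option.map_some, initList_eq, haltList_eq]
  exact (h a).choose_spec.2

/-- The program of a machine. -/
def _root_.Turing.FinTM2.toBlock (tm : FinTM2) : Block tm.K tm.Γ tm.σ where
  Label := tm.Λ
  finLabel := tm.ΛFin
  entry := tm.main
  code := tm.m

/-- A machine has to halt in its initial state with only the output on its stacks, which is the
convention of `Runs`; a machine given by a hypothesis can thus serve as a subroutine. -/
theorem runs_toBlock (h : TM2ComputableInPolyTime ea eb f) (a : α) :
    h.tm.toBlock.Runs (single h.tm.k₀ ((ea a).map h.inputAlphabet.symm))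
      (single h.tm.k₁ ((eb (f a)).map h.outputAlphabet.symm)) (h.time.eval (ea a).length) := by
  obtain ⟨⟨n, hn⟩, hle⟩ := h.outputsFun a
  rw [Option.map_some, initList_eq, haltList_eq] at hn
  exact ⟨n, hle, hn⟩

/-! ### The length of the output -/

/-- An upper bound for the number of symbols that a statement pushes. -/
def pushCount {Λ : Type} : TM2.Stmt Γ Λ σ → ℕ
  | .push _ _ q => pushCount q + 1
  | .peek _ _ q => pushCount q
  | .pop _ _ q => pushCount q
  | .load _ q => pushCount q
  | .branch _ q₁ q₂ => pushCount q₁ + pushCount q₂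
  | .goto _ => 0
  | .halt => 0

theorem length_stepAux_le {Λ : Type} (q : TM2.Stmt Γ Λ σ) (v : σ) (S : ∀ k, List (Γ k)) (k : K) :
    ((TM2.stepAux q v S).stk k).length ≤ (S k).length + pushCount q := by
  have upd : ∀ (k' : K) (l : List (Γ k')) (c : ℕ), l.length ≤ (S k').length + c →
      (Function.update S k' l k).length ≤ (S k).length + c := by
    intro k' l c h
    by_cases hk : k = k'
    · subst hk; simpa using h
    · simp [hk]
  induction q generalizing v S with
  | push k' g q ih =>
    have := upd k' (g v :: S k') 1 (by simp)
    -- The fact `upd` depends on `S`, so the induction hypothesis asks for it again at the updated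
    -- stacks.
    have := ih v (Function.update S k' (g v :: S k'))
      (fun k'' l c h => by by_cases hk : k = k'' <;> [(subst hk; simpa using h); simp [hk]])
    simp only [TM2.stepAux, pushCount]
    omega
  | pop k' g q ih =>
    have := upd k' (S k').tail 0 (by simp)
    have := ih (g v (S k').head?) (Function.update S k' (S k').tail)
      (fun k'' l c h => by by_cases hk : k = k'' <;> [(subst hk; simpa using h); simp [hk]])
    simp only [TM2.stepAux, pushCount]
    omega
  | peek k' g q ih => exact ih _ _ upd
  | load g q ih => exact ih _ _ upd
  | branch p q₁ q₂ ih₁ ih₂ =>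
    have h₁ := ih₁ v S upd
    have h₂ := ih₂ v S upd
    cases h : p v <;> simp only [TM2.stepAux, pushCount, h, cond_true, cond_false] <;> omega
  | goto => simp [pushCount]
  | halt => simp [pushCount]

/-- One step executes the code of one label, so no stack grows in a step by more than the push count
summed over all labels. -/
theorem Block.Runs.length_le [Inhabited σ] {B : Block K Γ σ} {S S' : ∀ k, List (Γ k)} {t : ℕ}
    (h : B.Runs S S' t) (k : K) :
    (S' k).length ≤ (S k).length + t * ∑ l, pushCount (B.code l) := by
  have key : ∀ (n : ℕ) (c c' : TM2.Cfg Γ B.Label σ),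
      (flip bind (TM2.step B.code))^[n] (some c) = some c' →
      (c'.stk k).length ≤ (c.stk k).length + n * ∑ l, pushCount (B.code l) := by
    intro n
    induction n with
    | zero => rintro c c' h; cases h; simp
    | succ n ih =>
      rintro ⟨_ | l, v, S⟩ c' h
      · rw [Function.iterate_succ_apply,
          show flip bind (TM2.step B.code) (some ⟨none, v, S⟩) = none from rfl,
          Function.iterate_fixed rfl n] at h
        cases h
      · have h₁ := ih (TM2.stepAux (B.code l) v S) c' h
        have h₂ := length_stepAux_le (B.code l) v S k
        have h₃ := Finset.single_le_sum (f := fun l => pushCount (B.code l))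
          (fun _ _ => Nat.zero_le _) (Finset.mem_univ l)
        simp only at h₃ ⊢
        rw [add_mul, one_mul]
        omega
  obtain ⟨n, hn, h⟩ := h
  exact (key n _ _ h).trans (by gcongr)

end

theorem Polynomial.eval_mono_nat (p : Polynomial ℕ) {m n : ℕ} (h : m ≤ n) : p.eval m ≤ p.eval n := by
  simp only [Polynomial.eval_eq_sum, Polynomial.sum]
  gcongr

theorem exists_length_output_le {α β αΓ βΓ : Type} {ea : α → List αΓ} {eb : β → List βΓ} {f : α → β}
    (h : TM2ComputableInPolyTime ea eb f) :
    ∃ p : Polynomial ℕ, ∀ a, (eb (f a)).length ≤ p.eval (ea a).length := by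
  refine ⟨Polynomial.X + h.time * Polynomial.C (∑ l, pushCount (h.tm.toBlock.code l)), fun a => ?_⟩
  have := (runs_toBlock h a).length_le h.tm.k₁
  simp only [single, Function.update_self, List.length_map] at this
  refine this.trans ?_
  simp only [Polynomial.eval_add, Polynomial.eval_X, Polynomial.eval_mul, Polynomial.eval_C]
  gcongr
  -- The output stack initially holds the input if it is the input stack, and is empty otherwise.
  -- Generalizing makes the equality of stacks substitutable despite the dependent alphabets.
  by_cases hk : h.tm.k₁ = h.tm.k₀
  · rw [← (List.length_map h.inputAlphabet.symm : _ = (ea a).length)]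
    revert hk
    generalize List.map h.inputAlphabet.symm (ea a) = l
    revert l
    generalize h.tm.k₀ = k₀
    rintro l rfl
    simp
  · simp [hk]

/-! ### Moving symbols between stacks -/

section

variable {K : Type} [DecidableEq K] {Γ : K → Type} {σ : Type} [Inhabited σ]

/-- Move the symbols of a stack to another one. -/
def move (k k' : K) [Fintype (Γ k)] [Reg σ (Γ k)] (f : Γ k → Γ k') : Block K Γ σ :=
  .forEach k fun x => .push k' (f x)

theorem runs_move {k k' : K} [Fintype (Γ k)] [Reg σ (Γ k)] (f : Γ k → Γ k') (hk : k ≠ k')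
    (S : ∀ k, List (Γ k)) :
    (move k k' f : Block K Γ σ).Runs S
      (Function.update (Function.update S k []) k' (((S k).map f).reverse ++ S k'))
      (3 * (S k).length + 3) := by
  generalize hl : S k = l
  induction l generalizing S with
  | nil =>
    refine (Block.runs_forEach_nil _ hl).congr rfl ?_ (by simp)
    have : Function.update S k [] = S := by rw [← hl, Function.update_eq_self]
    simp [this]
  | cons x l ih =>
    refine (Block.Runs.forEach_cons (B := fun x => .push k' (f x)) hl (Block.runs_push _ _ _)
      (ih _ (by simp [hk]))).congr rfl ?_ (by simp; omega)
    funext i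
    by_cases h1 : i = k'
    · subst h1; simp [hk.symm]
    · by_cases h2 : i = k
      · subst h2; simp [hk]
      · simp [h1, h2]

theorem runs_move_single {k k' : K} [Fintype (Γ k)] [Reg σ (Γ k)] (f : Γ k → Γ k') (hk : k ≠ k')
    (l : List (Γ k)) :
    (move k k' f : Block K Γ σ).Runs (single k l) (single k' (l.map f).reverse)
      (3 * l.length + 3) := by
  refine (runs_move f hk _).congr rfl ?_ (by simp [single])
  simp [single, hk.symm]

end

/-! ### Machines all of whose stacks have the same alphabet -/

section

variable {K A : Type} [DecidableEq K]

theorem runs_pushConst (k : K) (x : A) (S : K → List A) :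
    (Block.push k x : Block K (fun _ => A) (Option A)).Runs S (Function.update S k (x :: S k)) 1 :=
  Block.runs_push k x S

variable [Fintype A]

/-- Move the symbols of the stack `k` to the stack `k'`. -/
def transfer (k k' : K) : Block K (fun _ => A) (Option A) :=
  move k k' id

theorem runs_transfer {k k' : K} (hk : k ≠ k') (S : K → List A) :
    (transfer k k' : Block K (fun _ => A) (Option A)).Runs S
      (Function.update (Function.update S k []) k' ((S k).reverse ++ S k'))
      (3 * (S k).length + 3) :=
  (runs_move (Γ := fun _ => A) id hk S).congr rfl (by simp) le_rfl

/-- Remove all symbols from the stack `k`. -/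
def clear (k : K) : Block K (fun _ => A) (Option A) :=
  .forEach k fun _ => .skip

theorem runs_clear (k : K) (S : K → List A) :
    (clear k : Block K (fun _ => A) (Option A)).Runs S (Function.update S k [])
      (3 * (S k).length + 3) := by
  generalize hl : S k = l
  induction l generalizing S with
  | nil =>
    refine (Block.runs_forEach_nil _ hl).congr rfl ?_ (by simp)
    rw [← hl, Function.update_eq_self]
  | cons x l ih =>
    exact (Block.Runs.forEach_cons hl (Block.runs_skip _) (ih _ (by simp))).congr rfl (by simp)
      (by simp; omega)

end

/-! ### Composition -/

section

variable {K₁ K₂ : Type} {Γ : K₁ ⊕ K₂ → Type}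

/-- Put two families of stacks side by side. -/
def joinStacks (S : ∀ k, List (Γ (.inl k))) (T : ∀ k, List (Γ (.inr k))) : ∀ k, List (Γ k)
  | .inl k => S k
  | .inr k => T k

variable [DecidableEq K₁] [DecidableEq K₂]

theorem update_joinStacks_inl (S : ∀ k, List (Γ (.inl k))) (T : ∀ k, List (Γ (.inr k))) (k : K₁)
    (x : List (Γ (.inl k))) : Function.update (joinStacks S T) (Sum.inl k) x =
      joinStacks (Function.update S k x) T := by
  funext i
  rcases i with i | i
  · by_cases h : i = k
    · subst h; simp [joinStacks]
    · simp [joinStacks, h]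
  · simp [joinStacks]

theorem update_joinStacks_inr (S : ∀ k, List (Γ (.inl k))) (T : ∀ k, List (Γ (.inr k))) (k : K₂)
    (x : List (Γ (.inr k))) : Function.update (joinStacks S T) (Sum.inr k) x =
      joinStacks S (Function.update T k x) := by
  funext i
  rcases i with i | i
  · simp [joinStacks]
  · by_cases h : i = k
    · subst h; simp [joinStacks]
    · simp [joinStacks, h]

omit [DecidableEq K₁] [DecidableEq K₂] in
theorem joinStacks_nil :
    joinStacks (fun _ => []) (fun _ => []) = (fun _ => [] : ∀ k, List (Γ k)) := by
  funext i
  rcases i with i | i <;> rfl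

theorem joinStacks_single_left (k : K₁) (l : List (Γ (.inl k))) :
    joinStacks (single (Γ := fun k => Γ (.inl k)) k l) (fun _ => []) = single (Γ := Γ) (.inl k) l := by
  simp only [single, ← update_joinStacks_inl, joinStacks_nil]

theorem joinStacks_single_right (k : K₂) (l : List (Γ (.inr k))) :
    joinStacks (fun _ => []) (single (Γ := fun k => Γ (.inr k)) k l) = single (Γ := Γ) (.inr k) l := by
  simp only [single, ← update_joinStacks_inr, joinStacks_nil]

end

section

variable {K₁ K₂ : Type} [DecidableEq K₁] [DecidableEq K₂] {Γ : K₁ ⊕ (K₂ ⊕ Unit) → Type}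
  {σ₁ σ₂ R : Type} [Inhabited σ₁] [Inhabited σ₂] [Inhabited R]

/-- Execute `B₁`, move its output (on the stack `k₁`) to the input stack `k₂` of `B₂`, and execute
`B₂`. -/
def chain (B₁ : Block K₁ (fun k => Γ (.inl k)) σ₁) (B₂ : Block K₂ (fun k => Γ (.inr (.inl k))) σ₂)
    (k₁ : K₁) (k₂ : K₂) [Fintype (Γ (.inl k₁))] [Reg (σ₁ × (σ₂ × R)) (Γ (.inl k₁))]
    [Fintype (Γ (.inr (.inr ())))] [Reg (σ₁ × (σ₂ × R)) (Γ (.inr (.inr ())))]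
    (f : Γ (.inl k₁) → Γ (.inr (.inr ()))) (g : Γ (.inr (.inr ())) → Γ (.inr (.inl k₂))) :
    Block (K₁ ⊕ (K₂ ⊕ Unit)) Γ (σ₁ × (σ₂ × R)) :=
  (((B₁.lift Sum.inl Prod.fst fun s x => (x, s.2)).seq (move _ _ f)).seq (move _ _ g)).seq
    (B₂.lift (fun k => Sum.inr (Sum.inl k)) (fun s => s.2.1) fun s x => (s.1, x, s.2.2))

/-- A move reverses a word; passing the intermediate word through the auxiliary stack makes two
moves and restores its order. While one part of the machine works, the state components of the
others stay `default` and their stacks empty. -/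
theorem runs_chain {B₁ : Block K₁ (fun k => Γ (.inl k)) σ₁}
    {B₂ : Block K₂ (fun k => Γ (.inr (.inl k))) σ₂}
    {k₀ k₁ : K₁} {k₂ k₃ : K₂} [Fintype (Γ (.inl k₁))] [Reg (σ₁ × (σ₂ × R)) (Γ (.inl k₁))]
    [Fintype (Γ (.inr (.inr ())))] [Reg (σ₁ × (σ₂ × R)) (Γ (.inr (.inr ())))]
    (f : Γ (.inl k₁) → Γ (.inr (.inr ()))) (g : Γ (.inr (.inr ())) → Γ (.inr (.inl k₂)))
    {x : List (Γ (.inl k₀))} {y : List (Γ (.inl k₁))} {z : List (Γ (.inr (.inl k₃)))} {t₁ t₂ : ℕ}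
    (h₁ : B₁.Runs (single k₀ x) (single k₁ y) t₁)
    (h₂ : B₂.Runs (single k₂ (y.map fun a => g (f a))) (single k₃ z) t₂) :
    (chain (R := R) B₁ B₂ k₁ k₂ f g).Runs (single (.inl k₀) x) (single (.inr (.inl k₃)) z)
      (t₁ + 6 * y.length + 6 + t₂) := by
  have r₁ := h₁.lift (Γ := Γ) (e := Sum.inl) (get := Prod.fst)
    (upd := fun (s : σ₁ × (σ₂ × R)) x => (x, s.2)) (put := fun x => (x, default))
    (J := fun T => joinStacks T fun _ => []) (fun _ => rfl) (fun _ _ => rfl) rfl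
    (fun _ _ => rfl) (fun _ _ _ => update_joinStacks_inl _ _ _ _)
  have r₂ := h₂.lift (Γ := Γ) (e := fun k => Sum.inr (Sum.inl k)) (get := fun s => s.2.1)
    (upd := fun (s : σ₁ × (σ₂ × R)) x => (s.1, x, s.2.2))
    (put := fun x => (default, x, default))
    (J := fun T => joinStacks (fun _ => [])
      (joinStacks (Γ := fun k => Γ (.inr k)) T fun _ => []))
    (fun _ => rfl) (fun _ _ => rfl) rfl (fun _ _ => rfl)
    (fun _ _ _ => by rw [update_joinStacks_inr, update_joinStacks_inl])
  have m₁ := runs_move_single (σ := σ₁ × (σ₂ × R)) f (k := Sum.inl k₁)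
    (k' := Sum.inr (Sum.inr ())) (by simp) y
  have m₂ := runs_move_single (σ := σ₁ × (σ₂ × R)) g (k := Sum.inr (Sum.inr ()))
    (k' := Sum.inr (Sum.inl k₂)) (by simp)
    (y.map f).reverse
  refine (((r₁.congr (joinStacks_single_left _ _) (joinStacks_single_left _ _) le_rfl).seq m₁).seq
    m₂).seq (r₂.congr ?_ ?_ le_rfl) |>.mono ?_
  · rw [joinStacks_single_left (Γ := fun k => Γ (.inr k)), joinStacks_single_right]
    simp [Function.comp_def]
  · rw [joinStacks_single_left (Γ := fun k => Γ (.inr k)), joinStacks_single_right]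
  · simp; omega

end

/-- The intermediate word has length at most `p` of the input length, so the second machine needs at
most `h₂.time.comp p` steps, because polynomials over `ℕ` are monotone. -/
theorem computable_comp {α β γ αΓ βΓ γΓ : Type} {ea : α → List αΓ} {eb : β → List βΓ}
    {ec : γ → List γΓ} {f : α → β} {g : β → γ} (h₁ : TM2ComputableInPolyTime ea eb f)
    (h₂ : TM2ComputableInPolyTime eb ec g) : Nonempty (TM2ComputableInPolyTime ea ec (g ∘ f)) := by
  let _ := h₁.tm.kFin
  let _ := h₂.tm.kFin
  let _ := h₁.tm.σFin
  let _ := h₂.tm.σFin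
  -- A machine only guarantees that its input alphabet is finite, so finiteness of the intermediate
  -- alphabet comes from the second machine.
  let _ : Fintype βΓ := @Fintype.ofEquiv _ _ h₂.tm.Γk₀Fin h₂.inputAlphabet
  let Γ : h₁.tm.K ⊕ (h₂.tm.K ⊕ Unit) → Type := Sum.elim h₁.tm.Γ (Sum.elim h₂.tm.Γ fun _ => βΓ)
  let σ := h₁.tm.σ × (h₂.tm.σ × Option βΓ)
  let _ : Fintype (Γ (.inl h₁.tm.k₀)) := h₁.tm.Γk₀Fin
  let _ : Fintype (Γ (.inl h₁.tm.k₁)) := Fintype.ofEquiv βΓ h₁.outputAlphabet.symm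
  let _ : Fintype (Γ (.inr (.inr ()))) := ‹Fintype βΓ›
  let _ : Reg σ (Γ (.inr (.inr ()))) :=
    ⟨fun x => (default, default, x), fun s => s.2.2, fun _ => rfl⟩
  let _ : Reg σ (Γ (.inl h₁.tm.k₁)) := .ofEquiv (β := Γ (.inr (.inr ()))) h₁.outputAlphabet
  obtain ⟨p, hp⟩ := exists_length_output_le h₁
  refine computable_of_runs (chain (Γ := Γ) (R := Option βΓ) h₁.tm.toBlock h₂.tm.toBlock h₁.tm.k₁
    h₂.tm.k₀ h₁.outputAlphabet h₂.inputAlphabet.symm) (k₀ := .inl h₁.tm.k₀)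
    (k₁ := .inr (.inl h₂.tm.k₁)) h₁.inputAlphabet h₂.outputAlphabet
    (h₁.time + 6 * p + 6 + h₂.time.comp p) fun a => ?_
  have r₂ := runs_toBlock h₂ (f a)
  rw [show (eb (f a)).map h₂.inputAlphabet.symm =
    ((eb (f a)).map h₁.outputAlphabet.symm).map
      (fun x => h₂.inputAlphabet.symm (h₁.outputAlphabet x)) by simp] at r₂
  have r := runs_chain (Γ := Γ) (R := Option βΓ) h₁.outputAlphabet h₂.inputAlphabet.symm
    (runs_toBlock h₁ a) r₂
  have hlen : ((eb (f a)).map h₁.outputAlphabet.symm).length = (eb (f a)).length :=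
    List.length_map _
  refine r.mono ?_
  have := hp a
  have := Polynomial.eval_mono_nat h₂.time this
  simp only [Polynomial.eval_add, Polynomial.eval_mul, Polynomial.eval_comp, Polynomial.eval_ofNat]
  change _ + 6 * ((eb (f a)).map h₁.outputAlphabet.symm).length + 6 + _ ≤ _
  rw [hlen]
  gcongr

end StackMachine

/-! ### Handling of certificates, and closure of NP under reductions. -/

open Turing

namespace StackMachine

/-! ### Truncating a certificate -/

/-- The stacks of the machine that truncates certificates. -/
inductive ClockStack
  | inp | word | cert | cert' | len | len' | acc | acc'
  deriving DecidableEq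

namespace ClockStack

instance : Fintype ClockStack :=
  .ofList [inp, word, cert, cert', len, len', acc, acc'] fun k => by cases k <;> simp

variable {A : Type}

/-- The contents of all stacks. -/
def mk (a b c d e f g h : List A) : ClockStack → List A
  | inp => a
  | word => b
  | cert => c
  | cert' => d
  | len => e
  | len' => f
  | acc => g
  | acc' => h

section

variable (a b c d e f g h x : List A)

@[simp] theorem update_inp : Function.update (mk a b c d e f g h) inp x = mk x b c d e f g h := by
  funext k; cases k <;> rfl
@[simp] theorem update_word : Function.update (mk a b c d e f g h) word x = mk a x c d e f g h := by
  funext k; cases k <;> rfl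
@[simp] theorem update_cert : Function.update (mk a b c d e f g h) cert x = mk a b x d e f g h := by
  funext k; cases k <;> rfl
@[simp] theorem update_cert' :
    Function.update (mk a b c d e f g h) cert' x = mk a b c x e f g h := by
  funext k; cases k <;> rfl
@[simp] theorem update_len : Function.update (mk a b c d e f g h) len x = mk a b c d x f g h := by
  funext k; cases k <;> rfl
@[simp] theorem update_len' : Function.update (mk a b c d e f g h) len' x = mk a b c d e x g h := by
  funext k; cases k <;> rfl
@[simp] theorem update_acc : Function.update (mk a b c d e f g h) acc x = mk a b c d e f x h := by
  funext k; cases k <;> rfl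
@[simp] theorem update_acc' : Function.update (mk a b c d e f g h) acc' x = mk a b c d e f g x := by
  funext k; cases k <;> rfl

theorem single_inp : single inp x = mk x [] [] [] [] [] [] [] := by
  funext k; cases k <;> rfl

end

variable [Fintype A] (u : A)

/-- Multiply the unary number on `acc` by the one on `len`. -/
def mulBlock : Block ClockStack (fun _ => A) (Option A) :=
  (Block.forEach acc fun _ =>
    (Block.forEach len fun _ => (Block.push len' u).seq (Block.push acc' u)).seq
      (transfer len' len)).seq (transfer acc' acc)

theorem runs_copyLen (a b c d f g h : List A) (m : ℕ) :
    (Block.forEach len fun _ => (Block.push len' u).seq (Block.push acc' u) :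
      Block ClockStack (fun _ => A) (Option A)).Runs
      (mk a b c d (List.replicate m u) f g h)
      (mk a b c d [] (List.replicate m u ++ f) g (List.replicate m u ++ h)) (4 * m + 3) := by
  induction m generalizing f h with
  | zero => exact Block.runs_forEach_nil _ rfl
  | succ m ih =>
    refine (Block.Runs.forEach_cons (x := u) (l := List.replicate m u) rfl
      ((runs_pushConst _ _ _).seq (runs_pushConst _ _ _))
      ((ih (u :: f) (u :: h)).congr (by simp [mk]) rfl le_rfl)).congr rfl ?_ (by omega)
    simp [List.replicate_succ', List.append_assoc]

theorem runs_mulBlock (a b c d : List A) (m n : ℕ) :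
    (mulBlock u).Runs (mk a b c d (List.replicate m u) [] (List.replicate n u) [])
      (mk a b c d (List.replicate m u) [] (List.replicate (n * m) u) [])
      (n * (7 * m + 8) + 6 + 3 * (n * m)) := by
  -- Each unit of `acc` triggers one pass, which empties `len` onto both `len'` and `acc'` and then
  -- refills `len` from `len'`.
  have key : ∀ (n : ℕ) (h : List A),
      (Block.forEach acc fun _ => (Block.forEach len fun _ =>
        (Block.push len' u).seq (Block.push acc' u)).seq (transfer len' len) :
        Block ClockStack (fun _ => A) (Option A)).Runs
        (mk a b c d (List.replicate m u) [] (List.replicate n u) h)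
        (mk a b c d (List.replicate m u) [] [] (List.replicate (n * m) u ++ h))
        (n * (7 * m + 8) + 3) := by
    intro n
    induction n with
    | zero => intro h; simpa using Block.runs_forEach_nil _ rfl
    | succ n ih =>
      intro h
      refine (Block.Runs.forEach_cons (x := u) (l := List.replicate n u) rfl
        (((runs_copyLen u a b c d [] (List.replicate n u) h m).congr (by simp) rfl le_rfl).seq
          (runs_transfer (by decide) _)) ((ih (List.replicate m u ++ h)).congr
            (by simp [mk]) rfl le_rfl)).congr rfl ?_ ?_
      · rw [← List.append_assoc, ← List.replicate_add, add_mul, one_mul]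
      · simp [mk]; ring_nf; omega
  rw [mulBlock]
  refine ((key n []).seq (runs_transfer (k := acc') (k' := acc) (by decide) _)).congr rfl (by simp [mk]) ?_
  simp [mk]; omega

/-- Polynomials can be evaluated in polynomial time. -/
theorem exists_evalBlock (p : Polynomial ℕ) :
    ∃ (B : Block ClockStack (fun _ => A) (Option A)) (T : Polynomial ℕ),
      ∀ (a b c d : List A) (m : ℕ), B.Runs (mk a b c d (List.replicate m u) [] [] [])
        (mk a b c d (List.replicate m u) [] (List.replicate (p.eval m) u) []) (T.eval m) := by
  -- Horner's scheme needs only two operations: adding a constant, and multiplying by the number on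
  -- `len`.
  induction p using Polynomial.recOnHorner with
  | M0 => exact ⟨.skip, 1, fun a b c d m => by simpa using Block.runs_skip _⟩
  | MC p r _ _ ih =>
    obtain ⟨B, T, h⟩ := ih
    have hpush : ∀ r : ℕ, ∃ B' : Block ClockStack (fun _ => A) (Option A),
        ∀ (a b c d e f g h : List A), B'.Runs (mk a b c d e f g h)
          (mk a b c d e f (List.replicate r u ++ g) h) (r + 1) := by
      intro r
      induction r with
      | zero => exact ⟨.skip, fun a b c d e f g h => Block.runs_skip _⟩
      | succ r ih =>
        obtain ⟨B', hB'⟩ := ih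
        exact ⟨B'.seq (.push acc u), fun a b c d e f g h =>
          ((hB' a b c d e f g h).seq (runs_pushConst _ _ _)).congr rfl
            (by simp [mk, List.replicate_succ]) (by omega)⟩
    obtain ⟨B', hB'⟩ := hpush r
    refine ⟨B.seq B', T + Polynomial.C (r + 1), fun a b c d m => ?_⟩
    refine ((h a b c d m).seq (hB' _ _ _ _ _ _ _ _)).congr rfl ?_ (by simp)
    rw [← List.replicate_add]
    simp [add_comm]
  | MX p _ ih =>
    obtain ⟨B, T, h⟩ := ih
    refine ⟨B.seq (mulBlock u), T + p * (7 * Polynomial.X + 8) + 6 + 3 * (p * Polynomial.X),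
      fun a b c d m => ?_⟩
    refine ((h a b c d m).seq (runs_mulBlock u a b c d m _)).congr rfl (by simp) ?_
    simp; omega

/-- Pop symbols from `cert'` and push them to `cert` as long as there are symbols on `acc`. -/
def takeBlock : Block ClockStack (fun _ => A) (Option A) :=
  .forEach cert' fun x => .popCase acc fun o => o.elim .skip fun _ => .push cert x

/-- When `acc` is exhausted the loop goes on and discards symbols, so `cert'` always ends empty. If
the certificate is short, unused units remain on `acc`. -/
theorem runs_takeBlock (a b c e : List A) (l : List A) (n : ℕ) :
    takeBlock.Runs (mk a b c l e [] (List.replicate n u) [])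
      (mk a b ((l.take n).reverse ++ c) [] e [] (List.replicate (n - l.length) u) [])
      (5 * l.length + 3) := by
  induction l generalizing n c with
  | nil => exact (Block.runs_forEach_nil _ rfl).congr rfl (by simp) (by simp)
  | cons x l ih =>
    cases n with
    | zero =>
      refine (Block.Runs.forEach_cons (x := x) (l := l) rfl
        (.popCase_nil rfl (Block.runs_skip _))
        ((ih c 0).congr (by simp) rfl le_rfl)).congr rfl (by simp) (by simp; omega)
    | succ n =>
      have h : (Block.popCase acc fun o => o.elim .skip fun _ => .push cert x :
          Block ClockStack (fun _ => A) (Option A)).Runs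
          (mk a b c l e [] (List.replicate (n + 1) u) [])
          (mk a b (x :: c) l e [] (List.replicate n u) []) 3 :=
        .popCase_cons (x := u) (l := List.replicate n u) rfl
          ((runs_pushConst cert x _).congr rfl (by simp [mk]) le_rfl)
      refine (Block.Runs.forEach_cons (x := x) (l := l) rfl (h.congr (by simp) rfl le_rfl)
        (ih (x :: c) n)).congr rfl (by simp) (by simp; omega)

section

variable {L : Type} [Fintype L]

/-- Split the input into a word and a certificate, and count the letters of the word. -/
def readBlock : Block ClockStack (fun _ => L ⊕ Bool) (Option (L ⊕ Bool)) :=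
  .forEach inp fun x =>
    Sum.elim (fun a => (Block.push word (Sum.inl a)).seq (Block.push len (Sum.inr true)))
      (fun b => Block.push cert (Sum.inr b)) x

theorem runs_readBlock (xs : List L) (ws : List Bool) :
    readBlock.Runs (mk (xs.map Sum.inl ++ ws.map Sum.inr) [] [] [] [] [] [] [])
      (mk [] (xs.map Sum.inl).reverse (ws.map Sum.inr).reverse []
        (List.replicate xs.length (Sum.inr true)) [] [] []) (4 * (xs.length + ws.length) + 3) := by
  have h₂ : ∀ b c e : List (L ⊕ Bool), readBlock.Runs (mk (ws.map Sum.inr) b c [] e [] [] [])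
      (mk [] b ((ws.map Sum.inr).reverse ++ c) [] e [] [] []) (4 * ws.length + 3) := by
    induction ws with
    | nil => exact fun b c e => Block.runs_forEach_nil _ rfl
    | cons w ws ih =>
      intro b c e
      exact (Block.Runs.forEach_cons (x := Sum.inr w) (l := ws.map Sum.inr) rfl
        (runs_pushConst cert (Sum.inr w) _)
        ((ih b (Sum.inr w :: c) e).congr (by simp [mk]) rfl le_rfl)).congr rfl (by simp)
        (by simp; omega)
  have h₁ : ∀ b e : List (L ⊕ Bool),
      readBlock.Runs (mk (xs.map Sum.inl ++ ws.map Sum.inr) b [] [] e [] [] [])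
      (mk [] ((xs.map Sum.inl).reverse ++ b) (ws.map Sum.inr).reverse []
        (List.replicate xs.length (Sum.inr true) ++ e) [] [] [])
        (4 * (xs.length + ws.length) + 3) := by
    induction xs with
    | nil => exact fun b e => (h₂ b [] e).congr rfl (by simp) (by simp)
    | cons x xs ih =>
      intro b e
      refine (Block.Runs.forEach_cons (x := Sum.inl x) (l := xs.map Sum.inl ++ ws.map Sum.inr) rfl
        ((runs_pushConst word (Sum.inl x) _).seq (runs_pushConst len (Sum.inr true) _))
        ((ih (Sum.inl x :: b) (Sum.inr true :: e)).congr (by simp [mk]) rfl le_rfl)).congr rfl ?_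
        (by simp; omega)
      simp [List.replicate_succ']
  exact (h₁ [] []).congr rfl (by simp) le_rfl

end

end ClockStack

open ClockStack Crossing in
/-- Certificates can be truncated to a length that is polynomial in the length of the instance. -/
theorem computable_truncate (Q : DecisionProblem) (p : Polynomial ℕ) :
    Nonempty (TM2ComputableInPolyTime (encodeWithCertificate Q) (encodeWithCertificate Q)
      fun x => (x.1, x.2.take (p.eval (Q.encode x.1).length))) := by
  have := Q.finLetter
  obtain ⟨B, T, hB⟩ := exists_evalBlock (A := Q.Letter ⊕ Bool) (Sum.inr true) p
  -- Every pass reverses a word. Reading leaves the certificate reversed, so it goes to `cert'` to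
  -- bring its first bit to the top before truncation; the last two transfers put the certificate
  -- and then, above it, the word back in their original order.
  refine computable_of_runs (Γ := fun _ => Q.Letter ⊕ Bool) (k₀ := inp) (k₁ := inp)
    (((((((readBlock.seq B).seq (transfer cert cert')).seq takeBlock).seq (clear acc)).seq
      (clear len)).seq (transfer cert inp)).seq (transfer word inp))
    (.refl _) (.refl _) (T + 3 * p + 30 * Polynomial.X + 30) ?_
  rintro ⟨a, w⟩
  have h₁ := runs_readBlock (Q.encode a) w
  have h₂ := hB [] ((Q.encode a).map Sum.inl).reverse (w.map Sum.inr).reverse [] (Q.encode a).length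
  have h₃ := runs_transfer (k := cert) (k' := cert') (by decide)
    (mk [] ((Q.encode a).map Sum.inl).reverse (w.map Sum.inr).reverse []
      (List.replicate (Q.encode a).length (Sum.inr true)) []
      (List.replicate (p.eval (Q.encode a).length) (Sum.inr true)) [])
  have h₄ := runs_takeBlock (Sum.inr true) [] ((Q.encode a).map Sum.inl).reverse []
    (List.replicate (Q.encode a).length (Sum.inr true)) (w.map Sum.inr)
    (p.eval (Q.encode a).length)
  refine ((((((((h₁.seq h₂).seq h₃).seq (h₄.congr (by simp [mk]) rfl le_rfl)).seq
    (runs_clear _ _)).seq (runs_clear _ _)).seq (runs_transfer (by decide) _)).seq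
      (runs_transfer (by decide) _)).congr ?_ ?_ ?_)
  · simp [single_inp, encodeWithCertificate]
  · simp [single_inp, encodeWithCertificate, mk, List.map_take]
  · have h₅ := Polynomial.eval_mono_nat T (Nat.le_add_right (Q.encode a).length w.length)
    have h₆ := Polynomial.eval_mono_nat p (Nat.le_add_right (Q.encode a).length w.length)
    simp [encodeWithCertificate, mk]
    omega

/-! ### Machines that keep a certificate -/

section

variable {K : Type} [DecidableEq K] {Γ : K → Type} {σ : Type}

/-- All stacks but two are empty. -/
def pair (k k' : K) (l : List (Γ k)) (l' : List (Γ k')) : ∀ k, List (Γ k) :=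
  Function.update (single k l) k' l'

theorem pair_comm {k k' : K} (h : k ≠ k') (l : List (Γ k)) (l' : List (Γ k')) :
    pair k k' l l' = pair k' k l' l := by
  rw [pair, single, Function.update_comm h]
  rfl

variable [Inhabited σ]

theorem runs_move_pair {k k' i : K} [Fintype (Γ k)] [Reg σ (Γ k)] (f : Γ k → Γ k') (hk : k ≠ k')
    (hi : k ≠ i) (hi' : k' ≠ i) (l : List (Γ k)) (m : List (Γ i)) :
    (move k k' f : Block K Γ σ).Runs (pair k i l m) (pair k' i (l.map f).reverse m)
      (3 * l.length + 3) := by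
  refine (runs_move f hk _).congr rfl ?_ (by simp [pair, single, hi])
  funext j
  by_cases h₁ : j = k
  · subst h₁; simp [pair, single, hk, hi]
  · by_cases h₂ : j = k'
    · subst h₂; simp [pair, single, hi, hi', hk.symm]
    · by_cases h₃ : j = i
      · subst h₃; simp [pair, h₁, h₂]
      · simp [pair, single, h₁, h₂, h₃]

theorem runs_move_pair_join {k k' : K} [Fintype (Γ k)] [Reg σ (Γ k)] (f : Γ k → Γ k') (hk : k ≠ k')
    (l : List (Γ k)) (m : List (Γ k')) :
    (move k k' f : Block K Γ σ).Runs (pair k k' l m) (single k' ((l.map f).reverse ++ m))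
      (3 * l.length + 3) := by
  refine (runs_move f hk _).congr rfl ?_ (by simp [pair, single, hk])
  funext j
  by_cases h₁ : j = k
  · subst h₁; simp [single, hk]
  · by_cases h₂ : j = k'
    · subst h₂; simp [pair, single, hk]
    · simp [pair, single, h₁, h₂]

/-- Pop symbols and push each of them to one of two stacks. -/
def split {α β : Type} (k k₁ k₂ : K) [Fintype (Γ k)] [Reg σ (Γ k)] (e : Γ k → α ⊕ β)
    (f : α → Γ k₁) (g : β → Γ k₂) : Block K Γ σ :=
  .forEach k fun x => Sum.elim (fun a => .push k₁ (f a)) (fun b => .push k₂ (g b)) (e x)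

theorem runs_split {α β : Type} {k k₁ k₂ : K} [Fintype (Γ k)] [Reg σ (Γ k)] (e : Γ k ≃ α ⊕ β)
    (f : α → Γ k₁) (g : β → Γ k₂) (h₁ : k ≠ k₁) (h₂ : k ≠ k₂) (h₁₂ : k₁ ≠ k₂) (x : List α)
    (y : List β) :
    (split k k₁ k₂ e f g : Block K Γ σ).Runs (single k ((x.map Sum.inl ++ y.map Sum.inr).map e.symm))
      (pair k₁ k₂ (x.map f).reverse (y.map g).reverse) (3 * (x.length + y.length) + 3) := by
  have hy : ∀ (S : ∀ k, List (Γ k)), S k = (y.map Sum.inr).map e.symm →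
      (split k k₁ k₂ e f g : Block K Γ σ).Runs S
        (Function.update (Function.update S k []) k₂ ((y.map g).reverse ++ S k₂))
        (3 * y.length + 3) := by
    induction y with
    | nil =>
      intro S hS
      refine (Block.runs_forEach_nil _ hS).congr rfl ?_ (by simp)
      have : Function.update S k [] = S := by
        rw [Function.update_eq_self_iff, hS]; rfl
      simp [this]
    | cons b y ih =>
      intro S hS
      have hb := Block.runs_push (σ := σ) k₂ (g b)
        (Function.update S k ((y.map Sum.inr).map e.symm))
      refine (Block.Runs.forEach_cons hS (t₁ := 1) (by simpa using hb)
        (ih _ (by simp [h₂]))).congr rfl ?_ (by simp; omega)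
      rw [Function.update_comm h₂.symm, Function.update_idem, Function.update_idem]
      simp [h₂.symm]
  have hx : ∀ (S : ∀ k, List (Γ k)), S k = (x.map Sum.inl ++ y.map Sum.inr).map e.symm →
      (split k k₁ k₂ e f g : Block K Γ σ).Runs S
        (Function.update (Function.update (Function.update S k []) k₁ ((x.map f).reverse ++ S k₁)) k₂
          ((y.map g).reverse ++ S k₂)) (3 * (x.length + y.length) + 3) := by
    induction x with
    | nil =>
      intro S hS
      refine (hy S hS).congr rfl ?_ (by simp)
      have : Function.update (Function.update S k []) k₁ (S k₁) = Function.update S k [] := by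
        rw [Function.update_eq_self_iff]; simp [h₁.symm]
      simp [this]
    | cons a x ih =>
      intro S hS
      have ha := Block.runs_push (σ := σ) k₁ (f a)
        (Function.update S k ((x.map Sum.inl ++ y.map Sum.inr).map e.symm))
      refine (Block.Runs.forEach_cons hS (t₁ := 1) (by simpa using ha)
        (ih _ (by simp [h₁]))).congr rfl ?_ (by simp; omega)
      rw [Function.update_comm h₁.symm, Function.update_idem, Function.update_idem]
      simp [h₁.symm, h₂.symm, h₁₂.symm]
  refine (hx _ (by simp [single])).congr rfl ?_ le_rfl
  simp [single, pair, h₁.symm, h₂.symm]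

end

section

variable {K : Type} [DecidableEq K] {Γ : K ⊕ Fin 5 → Type} {σ R A A' : Type} [Inhabited σ]
  [Inhabited R] [∀ i, Fintype (Γ (.inr i))] [∀ i, Reg (σ × R) (Γ (.inr i))] (k₀ k₁ : K)
  [Fintype (Γ (.inl k₁))] [Reg (σ × R) (Γ (.inl k₁))]
  (e₀ : Γ (.inr 0) ≃ A ⊕ Bool) (e₁ : Γ (.inr 1) ≃ A) (e₂ : Γ (.inr 2) ≃ Bool)
  (e₃ : Γ (.inr 3) ≃ A') (e₄ : Γ (.inr 4) ≃ A' ⊕ Bool) (a₀ : Γ (.inl k₀) ≃ A)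
  (a₁ : Γ (.inl k₁) ≃ A')

/-- Execute `B` on the first part of the input and keep the second part. -/
def withCertificate (B : Block K (fun k => Γ (.inl k)) σ) : Block (K ⊕ Fin 5) Γ (σ × R) :=
  (((((split (.inr 0) (.inr 1) (.inr 2) e₀ e₁.symm e₂.symm).seq
    (move (.inr 1) (.inl k₀) fun x => a₀.symm (e₁ x))).seq
    (B.lift Sum.inl Prod.fst fun s x => (x, s.2))).seq
    (move (.inl k₁) (.inr 3) fun x => e₃.symm (a₁ x))).seq
    (move (.inr 2) (.inr 4) fun x => e₄.symm (.inr (e₂ x)))).seq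
    (move (.inr 3) (.inr 4) fun x => e₄.symm (.inl (e₃ x)))

/-- The certificate waits on the auxiliary stack 2 while `B` runs. Input, output and certificate are
each moved twice, so all orders are preserved; the certificate reaches stack 4 first and hence lies
below the output. -/
theorem runs_withCertificate {B : Block K (fun k => Γ (.inl k)) σ} {x : List A} {y : List A'}
    (w : List Bool) {t : ℕ} (h : B.Runs (single k₀ (x.map a₀.symm)) (single k₁ (y.map a₁.symm)) t) :
    (withCertificate (R := R) k₀ k₁ e₀ e₁ e₂ e₃ e₄ a₀ a₁ B).Runs
      (single (.inr 0) ((x.map Sum.inl ++ w.map Sum.inr).map e₀.symm))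
      (single (.inr 4) ((y.map Sum.inl ++ w.map Sum.inr).map e₄.symm))
      (t + 6 * x.length + 6 * y.length + 6 * w.length + 15) := by
  have hpair : ∀ (k : K) (l : List (Γ (.inl k))) (m : List (Γ (.inr 2))),
      joinStacks (single (Γ := fun k => Γ (.inl k)) k l) (single (Γ := fun k => Γ (.inr k)) 2 m) =
        pair (Γ := Γ) (.inl k) (.inr 2) l m := by
    intro k l m
    rw [pair, ← joinStacks_single_left, update_joinStacks_inr, single]
    rfl
  have r₀ := runs_split (σ := σ × R) e₀ e₁.symm e₂.symm (by simp) (by simp) (by simp) x w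
  have r₁ := runs_move_pair (σ := σ × R) (k := Sum.inr 1) (k' := Sum.inl k₀) (i := Sum.inr 2)
    (fun x => a₀.symm (e₁ x)) (by simp) (by simp) (by simp) (x.map e₁.symm).reverse
    (w.map e₂.symm).reverse
  have r₂ := h.lift (Γ := Γ) (e := Sum.inl) (get := Prod.fst)
    (upd := fun (s : σ × R) x => (x, s.2)) (put := fun x => (x, default))
    (J := fun T => joinStacks T (single (Γ := fun k => Γ (.inr k)) 2 (w.map e₂.symm).reverse))
    (fun _ => rfl) (fun _ _ => rfl) rfl
    (fun _ _ => rfl) (fun _ _ _ => update_joinStacks_inl _ _ _ _)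
  rw [hpair, hpair] at r₂
  have r₃ := runs_move_pair (σ := σ × R) (k := Sum.inl k₁) (k' := Sum.inr 3) (i := Sum.inr 2)
    (fun x => e₃.symm (a₁ x)) (by simp) (by simp) (by simp) (y.map a₁.symm)
    (w.map e₂.symm).reverse
  have r₄ := runs_move_pair (σ := σ × R) (k := Sum.inr 2) (k' := Sum.inr 4) (i := Sum.inr 3)
    (fun x => e₄.symm (.inr (e₂ x))) (by simp) (by simp) (by simp) (w.map e₂.symm).reverse
    ((y.map a₁.symm).map fun x => e₃.symm (a₁ x)).reverse
  have r₅ := runs_move_pair_join (σ := σ × R) (k := Sum.inr 3) (k' := Sum.inr 4)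
    (fun x => e₄.symm (.inl (e₃ x))) (by simp)
    ((y.map a₁.symm).map fun x => e₃.symm (a₁ x)).reverse
    (((w.map e₂.symm).reverse).map fun x => e₄.symm (.inr (e₂ x))).reverse
  refine (((((r₀.seq r₁).seq (r₂.congr ?_ rfl le_rfl)).seq r₃).seq
    (r₄.congr (pair_comm (by simp) _ _) (pair_comm (by simp) _ _) le_rfl)).seq r₅).congr rfl ?_ ?_
  · simp [Function.comp_def]
  · simp [Function.comp_def]
  · simp; omega

end

/-- The alphabets of the auxiliary stacks of a machine that keeps a certificate. -/
def CertAlphabet (A A' : Type) (i : Fin 5) : Type :=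
  match i with
  | 0 => A ⊕ Bool
  | 1 => A
  | 2 => Bool
  | 3 => A'
  | 4 => A' ⊕ Bool

instance CertAlphabet.fintype (A A' : Type) [Fintype A] [Fintype A'] (i : Fin 5) : Fintype (CertAlphabet A A' i) :=
  match i with
  | 0 => (inferInstance : Fintype (A ⊕ Bool))
  | 1 => ‹Fintype A›
  | 2 => (inferInstance : Fintype Bool)
  | 3 => ‹Fintype A'›
  | 4 => (inferInstance : Fintype (A' ⊕ Bool))

/-- Internal states that can hold a symbol of each of the alphabets `Δ i`. -/
@[reducible] def Reg.sigma {σ ι : Type} [Inhabited σ] [DecidableEq ι] (Δ : ι → Type) (i : ι) :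
    Reg (σ × Option (Σ i, Δ i)) (Δ i) where
  store x := (default, x.map (Sigma.mk i))
  read s := s.2.bind fun y => if h : y.1 = i then some (h ▸ y.2) else none
  read_store x := by cases x <;> simp

open Crossing in
theorem computable_withCertificate {Q Q' : DecisionProblem} {f : Q.Inst → Q'.Inst}
    (h : TM2ComputableInPolyTime Q.encode Q'.encode f) :
    Nonempty (TM2ComputableInPolyTime (encodeWithCertificate Q) (encodeWithCertificate Q')
      fun x => (f x.1, x.2)) := by
  have := Q.finLetter
  have := Q'.finLetter
  let _ := h.tm.kFin
  let _ := h.tm.σFin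
  let Δ := CertAlphabet Q.Letter Q'.Letter
  let Γ : h.tm.K ⊕ Fin 5 → Type := Sum.elim h.tm.Γ Δ
  let R := Option (Σ i, Δ i)
  let _ (i : Fin 5) : Fintype (Δ i) := CertAlphabet.fintype Q.Letter Q'.Letter i
  let _ (i : Fin 5) : Fintype (Γ (.inr i)) := CertAlphabet.fintype Q.Letter Q'.Letter i
  let _ : Fintype (Γ (.inl h.tm.k₁)) := Fintype.ofEquiv Q'.Letter h.outputAlphabet.symm
  let _ (i : Fin 5) : Reg (h.tm.σ × R) (Γ (.inr i)) := Reg.sigma Δ i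
  let _ : Reg (h.tm.σ × R) (Γ (.inl h.tm.k₁)) := .ofEquiv (β := Γ (.inr 3)) h.outputAlphabet
  obtain ⟨p, hp⟩ := exists_length_output_le h
  refine computable_of_runs (Γ := Γ) (withCertificate (R := R) h.tm.k₀ h.tm.k₁ (.refl _) (.refl _)
    (.refl _) (.refl _) (.refl _) h.inputAlphabet h.outputAlphabet h.tm.toBlock)
    (k₀ := .inr 0) (k₁ := .inr 4) (.refl _) (.refl _) (h.time + 6 * p + 6 * Polynomial.X + 15) ?_
  rintro ⟨a, w⟩
  refine (runs_withCertificate (Γ := Γ) (R := R) h.tm.k₀ h.tm.k₁ (.refl _) (.refl _)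
    (.refl _) (.refl _) (.refl _) h.inputAlphabet h.outputAlphabet w (runs_toBlock h a)).mono ?_
  have h₁ := hp a
  have h₂ := Polynomial.eval_mono_nat p (Nat.le_add_right (Q.encode a).length w.length)
  have h₃ := Polynomial.eval_mono_nat h.time (Nat.le_add_right (Q.encode a).length w.length)
  change _ + 6 * (Q.encode a).length + 6 * (Q'.encode (f a)).length + 6 * w.length + 15 ≤ _
  simp [encodeWithCertificate]
  omega

open Crossing in
/-- NP is closed under polynomial-time reductions. -/
theorem InNP.of_reduction {Q Q' : DecisionProblem} {f : Q.Inst → Q'.Inst}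
    (h : IsPolyTimeReduction Q Q' f) (hQ' : InNP Q') : InNP Q := by
  obtain ⟨⟨hf⟩, hred⟩ := h
  obtain ⟨p, V, ⟨hV⟩, hp⟩ := hQ'
  obtain ⟨q, hq⟩ := exists_length_output_le hf
  obtain ⟨h₁⟩ := computable_withCertificate hf
  obtain ⟨h₂⟩ := computable_truncate Q' p
  obtain ⟨h₃⟩ := computable_comp h₁ h₂
  refine ⟨p.comp q, _, computable_comp h₃ hV, fun a => ?_⟩
  rw [hred, hp]
  simp only [Function.comp_apply, Polynomial.eval_comp]
  constructor
  · rintro ⟨w, hw, hwV⟩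
    exact ⟨w, hw.trans (Polynomial.eval_mono_nat p (hq a)), by rwa [List.take_of_length_le hw]⟩
  · rintro ⟨w, _, hwV⟩
    exact ⟨_, List.length_take_le _ _, hwV⟩

open Crossing in
theorem IsPolyTimeReduction.comp {Q Q' Q'' : DecisionProblem} {f : Q.Inst → Q'.Inst}
    {g : Q'.Inst → Q''.Inst} (hg : IsPolyTimeReduction Q' Q'' g) (hf : IsPolyTimeReduction Q Q' f) :
    IsPolyTimeReduction Q Q'' (g ∘ f) :=
  ⟨computable_comp hf.1.some hg.1.some, fun a => (hf.2 a).trans (hg.2 (f a))⟩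

open Crossing in
theorem NPHard.of_reduction {Q Q' : DecisionProblem} {f : Q.Inst → Q'.Inst} (hQ : NPHard Q)
    (h : IsPolyTimeReduction Q Q' f) : NPHard Q' := fun A _ L hL =>
  let ⟨g, hg⟩ := hQ A L hL
  ⟨f ∘ g, IsPolyTimeReduction.comp h hg⟩

end StackMachine

/-! ### Crossings of `P_M` are switches of `M`; explicit form of the word of `P_M`. -/

open Turing

/-! ### Switches and crossings -/

namespace Crossing

theorem numChanges_const {n : ℕ} {α : Type} (a : α) : numChanges (fun _ : Fin n => a) = 0 := by
  simp [numChanges]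

theorem numChanges_comp {n : ℕ} {α β : Type} {g : α → β} (hg : Function.Injective g)
    (f : Fin n → α) : numChanges (fun i => g (f i)) = numChanges f := by
  simp [numChanges, hg.eq_iff]

/-- For a pair from different columns the comparison is constant in the voter. For the pair of one
column it is an injective function of the entry (being one, or being zero, depending on the order of
the pair), so it changes exactly where the column switches. -/
theorem isSwitchC1PWrt_iff (k : ℕ) {n m : ℕ} (M : Matrix (Fin n) (Fin m) Bool)
    (σ : Equiv.Perm (Fin n)) : IsSwitchC1PWrt k M σ ↔ IsCrossingWrt k (matrixProfile M) σ := by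
  have htrue : Function.Injective fun b : Bool => b = true := by
    intro a b h; cases a <;> cases b <;> simp_all
  have hfalse : Function.Injective fun b : Bool => b = false := by
    intro a b h; cases a <;> cases b <;> simp_all
  constructor
  · rintro h ⟨j, x⟩ ⟨j', y⟩ hne
    by_cases hj : j = j'
    · subst hj
      refine le_of_eq_of_le ?_ (h j)
      have hxy : x ≠ y := by rintro rfl; exact hne rfl
      have : x = 0 ∧ y = 1 ∨ x = 1 ∧ y = 0 := by omega
      rcases this with ⟨rfl, rfl⟩ | ⟨rfl, rfl⟩
      · simpa [matrixProfile] using numChanges_comp htrue fun i => M (σ i) j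
      · simpa [matrixProfile] using numChanges_comp hfalse fun i => M (σ i) j
    · simp [matrixProfile, hj, numChanges_const]
  · intro h j
    have := h (j, 0) (j, 1) (by simp)
    simp only [matrixProfile] at this
    rw [← numChanges_comp htrue]
    simpa using this

theorem isCrossingWrt_relabel {k n : ℕ} {C D : Type} (e : C ≃ D) (P : Profile (Fin n) C)
    (σ : Equiv.Perm (Fin n)) : IsCrossingWrt k (P.relabel e) σ ↔ IsCrossingWrt k P σ := by
  constructor
  · intro h c c' hc
    simpa [Profile.relabel] using h (e c) (e c') (by simpa using hc)
  · intro h c c' hc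
    exact h (e.symm c) (e.symm c') (by simpa using hc)

theorem isSwitchC1P_iff (k : ℕ) (x : (n : ℕ) × (m : ℕ) × Matrix (Fin n) (Fin m) Bool) :
    IsSwitchC1P k x.2.2 ↔ IsCrossing k (matrixToProfile x).2.2 :=
  exists_congr fun σ =>
    (isSwitchC1PWrt_iff k x.2.2 σ).trans (isCrossingWrt_relabel finProdFinEquiv _ σ).symm

/-! ### The word of the profile of a matrix -/

theorem encodeLines_cons (b : List Bool) (l : List (List Bool)) :
    encodeLines (b :: l) = b.map some ++ none :: encodeLines l := by
  simp [encodeLines]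

theorem encodeNats_append (l l' : List ℕ) : encodeNats (l ++ l') = encodeNats l ++ encodeNats l' :=
  List.flatMap_append

/-- A list that is sorted by the preferences of a voter and contains all candidates is the ranking
of the voter. -/
theorem Profile.ranking_eq {V : Type} {m : ℕ} (P : Profile V (Fin m)) (v : V) {l : List (Fin m)}
    (hl : l.Pairwise (P.pref v)) (hmem : ∀ c, c ∈ l) : P.ranking v = l := by
  have := P.strictTotal v
  have hnodup : l.Nodup := hl.imp fun h => ne_of_irrefl h
  refine List.Perm.eq_of_pairwise (fun a b _ _ h h' => (asymm_of (P.pref v) h h').elim)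
    (P.ranking_pairwise v) hl ?_
  refine (P.ranking_perm v).trans ?_
  rw [List.perm_ext_iff_of_nodup (List.nodup_finRange m) hnodup]
  simp [hmem]

/-- The ranking of the two candidates `c` and `c + 1` of a column with the entry `b`. -/
def cellRanking (c : ℕ) (b : Bool) : List ℕ :=
  bif b then [c, c + 1] else [c + 1, c]

/-- The ranking of the candidates of the columns with the entries `l`, of which the first candidate
is `c`. -/
def rowRanking : ℕ → List Bool → List ℕ
  | _, [] => []
  | c, b :: l => cellRanking c b ++ rowRanking (c + 2) l

theorem rowRanking_ofFn {m : ℕ} (c : ℕ) (f : Fin m → Bool) :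
    rowRanking c (List.ofFn f) =
      (List.finRange m).flatMap fun j : Fin m => cellRanking (c + 2 * (j : ℕ)) (f j) := by
  induction m generalizing c with
  | zero => rfl
  | succ m ih =>
    rw [List.ofFn_succ, rowRanking, ih, List.finRange_succ, List.flatMap_cons, List.flatMap_map]
    simp [mul_add, add_assoc, add_comm 2]

/-- Listing the columns in order, with the two candidates of each arranged by the entry, gives a
sorted list of all candidates, which `Profile.ranking_eq` identifies with the ranking. So the
ranking can be written in one pass over the row, without sorting. -/
theorem ranking_matrixToProfile {n m : ℕ} (M : Matrix (Fin n) (Fin m) Bool) (v : Fin n) :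
    (((matrixProfile M).relabel finProdFinEquiv).ranking v).map Fin.val =
      rowRanking 0 (List.ofFn fun j => M v j) := by
  have h : ((matrixProfile M).relabel finProdFinEquiv).ranking v =
      (List.finRange m).flatMap fun j =>
        (bif M v j then [(j, 0), (j, 1)] else [(j, 1), (j, 0)] : List (Fin m × Fin 2)).map
          finProdFinEquiv := by
    apply Profile.ranking_eq
    · rw [List.pairwise_flatMap]
      constructor
      · intro j _
        cases hM : M v j <;> simp [Profile.relabel, matrixProfile, hM, -finProdFinEquiv_symm_apply]
      · refine (List.pairwise_lt_finRange m).imp fun {i j} hij => ?_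
        cases M v i <;> cases M v j <;>
          simp [Profile.relabel, matrixProfile, hij, -finProdFinEquiv_symm_apply]
    · intro c
      obtain ⟨⟨j, x⟩, rfl⟩ := finProdFinEquiv.surjective c
      simp only [List.mem_flatMap, List.mem_finRange, true_and]
      refine ⟨j, ?_⟩
      fin_cases x <;> cases M v j <;> simp
  rw [h, List.map_flatMap, rowRanking_ofFn]
  congr 1
  funext j
  cases M v j <;> simp [cellRanking, finProdFinEquiv, add_comm]

theorem encodeProfile_matrixToProfile (x : (n : ℕ) × (m : ℕ) × Matrix (Fin n) (Fin m) Bool) :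
    encodeProfile (matrixToProfile x) = encodeLines (List.replicate (x.2.1 * 2) true ::
      (List.ofFn fun i : Fin x.1 => List.ofFn fun j : Fin x.2.1 => x.2.2 i j).map
        fun l => encodeNats (rowRanking 0 l)) := by
  simp only [encodeProfile, matrixToProfile, ranking_matrixToProfile, List.map_ofFn]
  rfl

end Crossing

/-! ### The map `M ↦ P_M` in polynomial time. -/

namespace StackMachine

open Crossing

/-! ### A machine for the profile of a matrix -/

/-- The stacks of the machine that computes the profile of a matrix. -/
inductive ProfileStack
  | inp | ctr | tmp | acc
  deriving DecidableEq

namespace ProfileStack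

instance : Fintype ProfileStack :=
  .ofList [inp, ctr, tmp, acc] fun k => by cases k <;> simp

/-- The contents of all stacks. -/
def mk {A : Type} (a b c d : List A) : ProfileStack → List A
  | inp => a
  | ctr => b
  | tmp => c
  | acc => d

section

variable {A : Type} (a b c d x : List A)

@[simp] theorem update_inp : Function.update (mk a b c d) inp x = mk x b c d := by
  funext k; cases k <;> rfl
@[simp] theorem update_ctr : Function.update (mk a b c d) ctr x = mk a x c d := by
  funext k; cases k <;> rfl
@[simp] theorem update_tmp : Function.update (mk a b c d) tmp x = mk a b x d := by
  funext k; cases k <;> rfl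
@[simp] theorem update_acc : Function.update (mk a b c d) acc x = mk a b c x := by
  funext k; cases k <;> rfl

theorem single_inp : single inp x = mk x [] [] [] := by
  funext k; cases k <;> rfl

end

/-- The programs of the machine. -/
abbrev Prog := Block ProfileStack (fun _ => Option Bool) (Option (Option Bool))

/-- Write the number `ctr` in unary. -/
def emit : Prog :=
  (Block.forEach ctr fun _ => (Block.push tmp (some true)).seq (Block.push acc (some true))).seq
    (transfer tmp ctr)

theorem runs_emit (a d : List (Option Bool)) (c : ℕ) :
    emit.Runs (mk a (List.replicate c (some true)) [] d)
      (mk a (List.replicate c (some true)) [] (List.replicate c (some true) ++ d)) (7 * c + 6) := by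
  have key : ∀ e d : List (Option Bool),
      (Block.forEach ctr fun _ => (Block.push tmp (some true)).seq (Block.push acc (some true)) :
        Prog).Runs (mk a (List.replicate c (some true)) e d)
        (mk a [] (List.replicate c (some true) ++ e) (List.replicate c (some true) ++ d))
        (4 * c + 3) := by
    induction c with
    | zero => exact fun e d => Block.runs_forEach_nil _ rfl
    | succ c ih =>
      intro e d
      refine (Block.Runs.forEach_cons (x := some true) (l := List.replicate c (some true)) rfl
        ((runs_pushConst tmp (some true) _).seq (runs_pushConst acc (some true) _))
        ((ih (some true :: e) (some true :: d)).congr (by simp [mk]) rfl le_rfl)).congr rfl ?_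
        (by omega)
      simp [List.replicate_succ']
  rw [emit]
  exact ((key [] d).seq (runs_transfer (k := tmp) (k' := ctr) (by decide) _)).congr rfl
    (by simp [mk]) (by simp [mk]; omega)

/-- Write the two candidates of a column with the entry `b`. -/
def cell (b : Bool) : Prog :=
  ((((((emit.seq (bif b then .skip else .push acc (some true))).seq (.push acc (some false))).seq
    emit).seq (bif b then .push acc (some true) else .skip)).seq (.push acc (some false))).seq
    (.push ctr (some true))).seq (.push ctr (some true))

/-- The counter is written twice, and one extra unit turns the second number (if `b`) or the first
(if not) into `c + 1`. Two further units then advance the counter to the next column. -/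
theorem runs_cell (a d : List (Option Bool)) (c : ℕ) (b : Bool) :
    (cell b).Runs (mk a (List.replicate c (some true)) [] d)
      (mk a (List.replicate (c + 2) (some true)) []
        (((encodeNats (cellRanking c b)).map some).reverse ++ d)) (14 * c + 18) := by
  have h := fun d => runs_emit a d c
  have h' := fun S x => runs_pushConst (A := Option Bool) acc x S
  have hc := fun S x => runs_pushConst (A := Option Bool) ctr x S
  cases b with
  | true =>
    refine ((((((((h d).seq (Block.runs_skip _)).seq (h' _ _)).seq ((h _).congr (by simp; rfl) rfl
      le_rfl)).seq (h' _ _)).seq (h' _ _)).seq (hc _ _)).seq (hc _ _)).congr rfl ?_ (by omega)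
    simp [mk, encodeNats, cellRanking, List.replicate_succ, ← List.replicate_succ']
  | false =>
    refine ((((((((h d).seq (h' _ _)).seq (h' _ _)).seq ((h _).congr (by simp; rfl) rfl
      le_rfl)).seq (Block.runs_skip _)).seq (h' _ _)).seq (hc _ _)).seq (hc _ _)).congr rfl ?_
      (by omega)
    simp [mk, encodeNats, cellRanking, List.replicate_succ, ← List.replicate_succ']

/-- Translate the rows of a matrix. -/
def rows : Prog :=
  .forEach inp fun x => x.elim ((Block.push acc none).seq (clear ctr)) cell

/-- A row is only a stretch of the loop over the whole input, so the rest of the run enters as the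
hypothesis `h`. The number `B` bounds the counter throughout the row and makes the cost per entry
uniform. -/
theorem runs_rows_append {r d : List (Option Bool)} {S : ProfileStack → List (Option Bool)} {B t : ℕ}
    (l : List Bool) (c : ℕ) (hB : c + 2 * l.length ≤ B)
    (h : rows.Runs (mk r (List.replicate (c + 2 * l.length) (some true)) []
      (((encodeNats (rowRanking c l)).map some).reverse ++ d)) S t) :
    rows.Runs (mk (l.map some ++ r) (List.replicate c (some true)) [] d) S
      (l.length * (14 * B + 20) + t) := by
  induction l generalizing c d with
  | nil => simpa [rowRanking, encodeNats] using h
  | cons b l ih =>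
    simp only [List.length_cons] at hB
    refine (Block.Runs.forEach_cons (x := some b) (l := l.map some ++ r) rfl
      ((runs_cell _ d c b).congr (by simp) rfl le_rfl)
      (ih (c + 2) (by omega) (h.congr ?_ rfl le_rfl))).congr rfl rfl ?_
    · rw [rowRanking, encodeNats_append]
      simp [mul_add, add_assoc, add_comm 2]
    · simp only [List.length_cons, add_mul, one_mul]
      omega

theorem runs_rows (L : List (List Bool)) (m : ℕ) (hL : ∀ l ∈ L, l.length = m)
    (d : List (Option Bool)) :
    rows.Runs (mk (encodeLines L) [] [] d)
      (mk [] [] [] ((encodeLines (L.map fun l => encodeNats (rowRanking 0 l))).reverse ++ d))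
      (L.length * (m * (28 * m + 20) + 6 * m + 6) + 3) := by
  induction L generalizing d with
  | nil => exact (Block.runs_forEach_nil _ rfl).congr rfl (by simp [encodeLines]) (by simp)
  | cons l L ih =>
    have hl : l.length = m := hL l (by simp)
    have h := ih (fun l hl => hL l (by simp [hl]))
      (none :: (((encodeNats (rowRanking 0 l)).map some).reverse ++ d))
    have h₁ : ((Block.push acc none).seq (clear ctr) : Prog).Runs
        (mk (encodeLines L) (List.replicate (0 + 2 * l.length) (some true)) []
          (((encodeNats (rowRanking 0 l)).map some).reverse ++ d))
        (mk (encodeLines L) [] [] (none :: (((encodeNats (rowRanking 0 l)).map some).reverse ++ d)))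
        (6 * m + 4) :=
      ((runs_pushConst acc none _).seq (runs_clear ctr _)).congr rfl (by simp [mk])
        (by simp [mk]; omega)
    have h₂ := runs_rows_append (r := none :: encodeLines L) (B := 2 * m) (d := d) l 0 (by omega)
      (Block.Runs.forEach_cons (x := none) (l := encodeLines L) rfl (h₁.congr (by simp) rfl le_rfl) h)
    refine h₂.congr (by simp [encodeLines_cons]) (by simp [encodeLines_cons]) ?_
    rw [hl, List.length_cons, add_mul, one_mul]
    ring_nf
    omega

/-- Translate the first line. -/
def header : Prog :=
  .popLoop inp (fun x => decide (x = some (some true))) fun x =>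
    bif decide (x = some (some true)) then
      (Block.push acc (some true)).seq (Block.push acc (some true))
    else Block.push acc none

theorem runs_header (r d : List (Option Bool)) (m : ℕ) :
    header.Runs (mk ((List.replicate m true).map some ++ none :: r) [] [] d)
      (mk r [] [] (none :: ((List.replicate (m * 2) true).map some ++ d))) (4 * m + 3) := by
  induction m generalizing d with
  | zero =>
    exact (Block.Runs.popLoop_exit (x := none) (l := r) rfl rfl (runs_pushConst acc none _)).congr
      rfl (by simp [mk]) (by omega)
  | succ m ih =>
    refine (Block.Runs.popLoop_again (x := some true)
      (l := (List.replicate m true).map some ++ none :: r) rfl rfl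
      ((runs_pushConst acc (some true) _).seq (runs_pushConst acc (some true) _))
      ((ih (some true :: some true :: d)).congr (by simp [mk]) rfl le_rfl)).congr rfl ?_ (by omega)
    simp [add_mul, List.replicate_succ']

end ProfileStack

theorem length_encodeLines (L : List (List Bool)) (m : ℕ) (hL : ∀ l ∈ L, l.length = m) :
    (encodeLines L).length = L.length * (m + 1) := by
  induction L with
  | nil => simp [encodeLines]
  | cons l L ih =>
    rw [encodeLines_cons, List.length_append, List.length_cons, List.length_map, hL l (by simp),
      ih fun l hl => hL l (by simp [hl]), List.length_cons]
    ring

theorem length_encodeMatrix (x : (n : ℕ) × (m : ℕ) × Matrix (Fin n) (Fin m) Bool) :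
    (encodeMatrix x).length = (x.1 + 1) * (x.2.1 + 1) := by
  rw [encodeMatrix, length_encodeLines _ x.2.1]
  · simp
  · simp only [List.mem_cons, List.mem_ofFn]
    rintro l (rfl | ⟨i, rfl⟩) <;> simp

theorem length_encodeNats_rowRanking (c B : ℕ) (l : List Bool) (hB : c + 2 * l.length ≤ B) :
    (encodeNats (rowRanking c l)).length ≤ l.length * (2 * B + 3) := by
  induction l generalizing c with
  | nil => simp [rowRanking, encodeNats]
  | cons b l ih =>
    simp only [List.length_cons] at hB
    have := ih (c + 2) (by omega)
    rw [rowRanking, encodeNats_append, List.length_append, List.length_cons, add_mul, one_mul]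
    have : (encodeNats (cellRanking c b)).length = 2 * c + 3 := by
      cases b <;> simp [cellRanking, encodeNats] <;> omega
    omega

open ProfileStack in
theorem computable_matrixToProfile :
    Nonempty (TM2ComputableInPolyTime encodeMatrix encodeProfile matrixToProfile) := by
  refine computable_of_runs (Γ := fun _ => Option Bool) (k₀ := inp) (k₁ := inp)
    ((header.seq rows).seq (transfer acc inp)) (.refl _) (.refl _)
    -- The running time is of order at most `(n + 1) * (m + 1) ^ 2`, and the input has length `(n +
    -- 1) * (m + 1)`, so a quadratic bound suffices.
    (100 * (Polynomial.X + 1) ^ 2) ?_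
  rintro ⟨n, m, M⟩
  set L := List.ofFn fun i : Fin n => List.ofFn fun j : Fin m => M i j with hL
  have hlen : ∀ l ∈ L, l.length = m := by
    simp only [hL, List.mem_ofFn]
    rintro l ⟨i, rfl⟩
    simp
  have hn : L.length = n := by simp [hL]
  have hout : (encodeLines (L.map fun l => encodeNats (rowRanking 0 l))).length ≤
      n * (m * (4 * m + 3) + 1) := by
    rw [← hn]
    clear_value L
    clear hn hL
    induction L with
    | nil => simp [encodeLines]
    | cons l L ih =>
      have h₁ := ih fun l hl => hlen l (by simp [hl])
      have h₂ := length_encodeNats_rowRanking 0 (2 * m) l (by rw [hlen l (by simp)]; omega)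
      rw [hlen l (by simp)] at h₂
      rw [List.map_cons, encodeLines_cons, List.length_append, List.length_cons, List.length_map,
        List.length_cons, add_mul, one_mul]
      ring_nf at h₁ h₂ ⊢
      omega
  refine (((runs_header (encodeLines L) [] m).seq (runs_rows L m hlen _)).seq
    (runs_transfer (k := acc) (k' := inp) (by decide) _)).congr ?_ ?_ ?_
  · simp [single_inp, encodeMatrix, encodeLines_cons, hL]
  · simp [single_inp, encodeProfile_matrixToProfile, encodeLines_cons, hL, mk]
  · rw [length_encodeMatrix, hn]
    simp only [mk, List.length_append, List.length_reverse, List.length_cons, List.length_map,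
      List.length_replicate, List.length_nil, Polynomial.eval_mul, Polynomial.eval_ofNat,
      Polynomial.eval_pow, Polynomial.eval_add, Polynomial.eval_X, Polynomial.eval_one]
    nlinarith [hout, Nat.zero_le (n * m), Nat.zero_le (n ^ 2 * m), Nat.zero_le (n * m ^ 2),
      Nat.zero_le (n ^ 2 * m ^ 2), Nat.zero_le (n ^ 2), Nat.zero_le (m ^ 2)]

end StackMachine

/-! ### Comparing two candidates in a ranking by a stack program. -/

open Turing

namespace StackMachine

open Crossing

/-! ### A machine for the comparison matrix of a profile -/

/-- Which of the candidates `c`, `c'` comes first in a ranking: `some true` if it is `c`. -/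
def firstOf (c c' : ℕ) : List ℕ → Option Bool
  | [] => none
  | b :: l => if b = c then some true else if b = c' then some false else firstOf c c' l

/-- The stacks of the machine that computes the comparison matrix of a profile. -/
inductive MatrixStack
  | inp | line | outer | row | row' | inner | col | col' | flag | acc
  deriving DecidableEq

namespace MatrixStack

instance : Fintype MatrixStack :=
  .ofList [inp, line, outer, row, row', inner, col, col', flag, acc] fun k => by cases k <;> simp

/-- The contents of all stacks. -/
def mk {A : Type} (a b c d e f g h i j : List A) : MatrixStack → List A
  | inp => a
  | line => b
  | outer => c
  | row => d
  | row' => e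
  | inner => f
  | col => g
  | col' => h
  | flag => i
  | acc => j

section

variable {A : Type} (a b c d e f g h i j x : List A)

@[simp] theorem update_inp :
    Function.update (mk a b c d e f g h i j) inp x = mk x b c d e f g h i j := by
  funext k; cases k <;> rfl
@[simp] theorem update_line :
    Function.update (mk a b c d e f g h i j) line x = mk a x c d e f g h i j := by
  funext k; cases k <;> rfl
@[simp] theorem update_outer :
    Function.update (mk a b c d e f g h i j) outer x = mk a b x d e f g h i j := by
  funext k; cases k <;> rfl
@[simp] theorem update_row :
    Function.update (mk a b c d e f g h i j) row x = mk a b c x e f g h i j := by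
  funext k; cases k <;> rfl
@[simp] theorem update_row' :
    Function.update (mk a b c d e f g h i j) row' x = mk a b c d x f g h i j := by
  funext k; cases k <;> rfl
@[simp] theorem update_inner :
    Function.update (mk a b c d e f g h i j) inner x = mk a b c d e x g h i j := by
  funext k; cases k <;> rfl
@[simp] theorem update_col :
    Function.update (mk a b c d e f g h i j) col x = mk a b c d e f x h i j := by
  funext k; cases k <;> rfl
@[simp] theorem update_col' :
    Function.update (mk a b c d e f g h i j) col' x = mk a b c d e f g x i j := by
  funext k; cases k <;> rfl
@[simp] theorem update_flag :
    Function.update (mk a b c d e f g h i j) flag x = mk a b c d e f g h x j := by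
  funext k; cases k <;> rfl
@[simp] theorem update_acc :
    Function.update (mk a b c d e f g h i j) acc x = mk a b c d e f g h i x := by
  funext k; cases k <;> rfl

theorem single_inp : single inp x = mk x [] [] [] [] [] [] [] [] [] := by
  funext k; cases k <;> rfl

end

/-- The programs of the machine. -/
abbrev Prog := Block MatrixStack (fun _ => Option Bool) (Option (Option Bool))

/-- The number `n` in unary. -/
abbrev unary (n : ℕ) : List (Option Bool) := List.replicate n (some true)

/-- Two nested loops, each over the numbers below the one on `outer` (or `inner`). The current
numbers are on `row` and `col`. -/
def doubleLoop (B : Prog) : Prog :=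
  (Block.forEach outer fun _ =>
    ((Block.forEach inner fun _ => B.seq (Block.push col (some true))).seq
      (transfer col inner)).seq (Block.push row (some true))).seq (transfer row outer)

/-- In `hB`, `x` and `y` are the rounds still to come and must not influence the body. The rounds
done are counted on `row` and `col`, which serve both as the current indices and to refill `outer`
and `inner` afterwards. -/
theorem runs_doubleLoop {B : Prog} {m t : ℕ} {i : List (Option Bool)} (f : ℕ → ℕ → Bool)
    (hB : ∀ c c' x y d, c < m → c' < m →
      B.Runs (mk i [] (unary x) (unary c) [] (unary y) (unary c') [] [] d)
        (mk i [] (unary x) (unary c) [] (unary y) (unary c') [] [] (some (f c c') :: d)) t)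
    (d : List (Option Bool)) :
    (doubleLoop B).Runs (mk i [] (unary m) [] [] (unary m) [] [] [] d)
      (mk i [] (unary m) [] [] (unary m) [] [] []
        ((((List.range m).flatMap fun c => (List.range m).map (f c)).map some).reverse ++ d))
      (m * (m * (t + 6) + 9) + 3 * m + 6) := by
  have hinner : ∀ (c x y c' : ℕ) (d : List (Option Bool)), c < m → c' + y ≤ m →
      (Block.forEach inner fun _ => B.seq (Block.push col (some true)) : Prog).Runs
        (mk i [] (unary x) (unary c) [] (unary y) (unary c') [] [] d)
        (mk i [] (unary x) (unary c) [] [] (unary (y + c')) [] []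
          ((((List.range' c' y).map (f c)).map some).reverse ++ d)) (y * (t + 3) + 3) := by
    intro c x y
    induction y with
    | zero =>
      intro c' d _ _
      exact (Block.runs_forEach_nil _ rfl).congr rfl (by simp) (by simp)
    | succ y ih =>
      intro c' d hc hc'
      refine (Block.Runs.forEach_cons (x := some true) (l := unary y) rfl
        (((hB c c' x y d hc (by omega)).congr (by simp) rfl le_rfl).seq
          (runs_pushConst col (some true) _))
        ((ih (c' + 1) (some (f c c') :: d) hc (by omega)).congr (by simp [mk, List.replicate_succ])
          rfl le_rfl)).congr rfl ?_ ?_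
      · rw [List.range'_succ, show y + (c' + 1) = y + 1 + c' by omega]
        simp
      · rw [add_mul, one_mul]; omega
  have houter : ∀ (x c : ℕ) (d : List (Option Bool)), c + x ≤ m →
      (Block.forEach outer fun _ =>
        ((Block.forEach inner fun _ => B.seq (Block.push col (some true))).seq
          (transfer col inner)).seq (Block.push row (some true)) : Prog).Runs
        (mk i [] (unary x) (unary c) [] (unary m) [] [] [] d)
        (mk i [] [] (unary (x + c)) [] (unary m) [] [] []
          ((((List.range' c x).flatMap fun c => (List.range m).map (f c)).map some).reverse ++ d))
        (x * (m * (t + 6) + 9) + 3) := by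
    intro x
    induction x with
    | zero =>
      intro c d _
      exact (Block.runs_forEach_nil _ rfl).congr rfl (by simp) (by simp)
    | succ x ih =>
      intro c d hc
      refine (Block.Runs.forEach_cons (x := some true) (l := unary x) rfl
        ((((hinner c x m 0 d (by omega) (by omega)).congr (by simp) rfl le_rfl).seq
          (runs_transfer (k := col) (k' := inner) (by decide) _)).seq
          (runs_pushConst row (some true) _))
        ((ih (c + 1) _ (by omega)).congr (by simp [mk, List.replicate_succ]; rfl)
          rfl le_rfl)).congr rfl ?_ ?_
      · rw [List.range'_succ, show x + (c + 1) = x + 1 + c by omega, List.range_eq_range']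
        simp
      · simp only [mk, List.length_replicate, add_zero]
        ring_nf
        omega
  rw [doubleLoop]
  refine ((houter m 0 d (by omega)).seq
    (runs_transfer (k := row) (k' := outer) (by decide) _)).congr rfl ?_ ?_
  · simp [mk, ← List.range_eq_range']
  · simp [mk]; omega

/-! #### Comparison of a unary number with a counter -/

section Counter

variable {k k' : MatrixStack} {S : MatrixStack → List (Option Bool)}

/-- Read one unit of a number that is compared with the counter `k`. -/
def tick (k k' : MatrixStack) : Prog :=
  .popCase k fun x => x.elim (.push k' (some false)) fun _ => .push k' (some true)

/-- What is left of the counter `c` after `i` units have been read. -/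
def left (c i : ℕ) : List (Option Bool) := unary (c - i)

/-- What has been moved from the counter `c` after `i` units have been read. -/
def moved (c i : ℕ) : List (Option Bool) :=
  List.replicate (i - c) (some false) ++ unary (min i c)

/-- On `k'`, `some true` stands for a unit taken from the counter and `some false` for a unit read
in excess of it. Thus the counter can be recovered, and the sign of `i - c` is visible at the tops
of the two stacks. -/
theorem runs_tick (hk : k ≠ k') (c i : ℕ) (h : S k = left c i) (h' : S k' = moved c i) :
    (tick k k').Runs S
      (Function.update (Function.update S k (left c (i + 1))) k' (moved c (i + 1))) 3 := by
  by_cases hi : i < c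
  · have hl : S k = some true :: left c (i + 1) := by
      rw [h, left, left, show c - i = c - (i + 1) + 1 by omega]
      rfl
    refine (Block.Runs.popCase_cons hl (runs_pushConst k' (some true) _)).congr rfl ?_ le_rfl
    congr 1
    rw [Function.update_of_ne hk.symm, h', moved, moved, show i - c = 0 by omega,
      show i + 1 - c = 0 by omega, min_eq_left hi.le, min_eq_left (by omega)]
    rfl
  · have hl : S k = [] := by
      rw [h, left, show c - i = 0 by omega]
      rfl
    refine (Block.Runs.popCase_nil hl (runs_pushConst k' (some false) _)).congr rfl ?_ le_rfl
    have hl' : Function.update S k (left c (i + 1)) = S := by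
      rw [left, show c - (i + 1) = 0 by omega, show unary 0 = [] from rfl, ← hl,
        Function.update_eq_self]
    rw [hl', h', moved, moved, show i + 1 - c = i - c + 1 by omega, min_eq_right (by omega),
      min_eq_right (by omega)]
    rfl

/-- Restore the counter `k`. -/
def restore (k k' : MatrixStack) : Prog :=
  .forEach k' fun x => bif x == some true then .push k (some true) else .skip

theorem runs_restore (hk : k ≠ k') (a b c : ℕ) (h : S k = unary a)
    (h' : S k' = List.replicate b (some false) ++ unary c) :
    (restore k k').Runs S (Function.update (Function.update S k (unary (a + c))) k' [])
      (3 * (b + c) + 3) := by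
  induction b generalizing S with
  | zero =>
    induction c generalizing S a with
    | zero =>
      refine (Block.runs_forEach_nil _ h').congr rfl ?_ le_rfl
      rw [add_zero, ← h, Function.update_eq_self]
      have : ([] : List (Option Bool)) = S k' := by rw [h']; rfl
      rw [this, Function.update_eq_self]
    | succ c ih =>
      refine (Block.Runs.forEach_cons (x := some true) (l := unary c) h'
        (runs_pushConst k (some true) _)
        (ih (a + 1) (by simp [hk, h, List.replicate_succ]) (by simp [hk.symm]))).congr rfl ?_
          (by omega)
      rw [show a + 1 + c = a + (c + 1) by omega]
      funext j
      by_cases h1 : j = k'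
      · subst h1; simp
      · by_cases h2 : j = k
        · subst h2; simp [hk]
        · simp [h1, h2]
  | succ b ih =>
    refine (Block.Runs.forEach_cons (x := some false)
      (l := List.replicate b (some false) ++ unary c) h' (Block.runs_skip _)
      (ih (by simp [hk, h]) (by simp))).congr rfl ?_ (by omega)
    rw [Function.update_comm hk, Function.update_idem, Function.update_comm hk]

/-- Restore the counter `k`, and execute `E` if the number that has been read is equal to it. -/
def settle (k k' : MatrixStack) (E : Prog) : Prog :=
  .popCase k fun x => x.elim
    (.popCase k' fun y => y.elim E fun y => bif y == some true then
      ((Block.push k (some true)).seq (restore k k')).seq E else restore k k')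
    fun _ => (Block.push k (some true)).seq (restore k k')

/-- The tops decide: `i < c` iff `k` is nonempty, `i > c` iff an excess mark is on top of `k'`, and
`i = c` otherwise. If `i = c = 0` both stacks are empty, which is a separate branch of the program.
-/
theorem runs_settle (hk : k ≠ k') (c i B : ℕ) (hi : i ≤ B) (hc : c ≤ B) (h : S k = left c i)
    (h' : S k' = moved c i) {E : Prog} {S' : MatrixStack → List (Option Bool)} {t : ℕ}
    (hE : E.Runs (Function.update (Function.update S k (unary c)) k' []) S' t) :
    (settle k k' E).Runs S
      (if i = c then S' else Function.update (Function.update S k (unary c)) k' [])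
      (3 * B + 8 + t) := by
  rcases lt_trichotomy i c with hic | rfl | hic
  · rw [if_neg hic.ne]
    have hl : S k = some true :: unary (c - i - 1) := by
      rw [h, left, show c - i = c - i - 1 + 1 by omega]
      rfl
    refine (Block.Runs.popCase_cons hl ((runs_pushConst k (some true) _).seq
      (runs_restore hk (c - i) 0 i ?_ ?_))).congr rfl ?_ (by omega)
    · rw [Function.update_idem, Function.update_self, Function.update_self,
        show c - i = c - i - 1 + 1 by omega]
      rfl
    · simp [hk.symm, h', moved, min_eq_left hic.le, show i - c = 0 by omega]
    · rw [show c - i + i = c by omega, Function.update_idem, Function.update_idem]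
  · rw [if_pos rfl]
    have hl : S k = [] := by simp [h, left]
    cases i with
    | zero =>
      have hl' : S k' = [] := by simp [h', moved]
      refine (Block.Runs.popCase_nil hl (Block.Runs.popCase_nil hl' (hE.congr ?_ rfl
        le_rfl))).congr rfl rfl (by omega)
      have h1 : Function.update S k (unary 0) = S := by
        rw [show unary 0 = [] from rfl, ← hl, Function.update_eq_self]
      rw [h1, ← hl', Function.update_eq_self]
    | succ i =>
      have hl' : S k' = some true :: unary i := by
        rw [h', moved, Nat.sub_self, min_self]
        rfl
      refine (Block.Runs.popCase_nil hl (Block.Runs.popCase_cons hl'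
        (((runs_pushConst k (some true) _).seq (runs_restore hk 1 0 i ?_ ?_)).seq
          (hE.congr ?_ rfl le_rfl)))).congr rfl rfl (by omega)
      · simp [hk, hl]
      · simp [hk.symm]
      · funext j
        by_cases h1 : j = k'
        · subst h1; simp
        · by_cases h2 : j = k
          · subst h2; simp [hk, add_comm 1 i]
          · simp [h1, h2]
  · rw [if_neg hic.ne']
    have hl : S k = [] := by simp [h, left, show c - i = 0 by omega]
    have hl' : S k' = some false :: (List.replicate (i - c - 1) (some false) ++ unary c) := by
      rw [h', moved, min_eq_right hic.le, show i - c = i - c - 1 + 1 by omega]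
      rfl
    refine (Block.Runs.popCase_nil hl (Block.Runs.popCase_cons hl'
      (runs_restore hk 0 (i - c - 1) c ?_ ?_))).congr rfl ?_ (by omega)
    · simp [hk, hl]
    · simp
    · rw [zero_add, Function.update_comm hk, Function.update_idem, Function.update_comm hk]

end Counter

/-! #### Comparison of two candidates -/

/-- The flag as the contents of a stack. -/
def flagStack (o : Option Bool) : List (Option Bool) := o.elim [] fun b => [some b]

/-- Set the flag to `x` if it is not set. -/
def setFlag (x : Bool) : Prog :=
  .popCase flag fun y => .push flag (y.elim (some x) id)

theorem runs_setFlag (x : Bool) (S : MatrixStack → List (Option Bool)) (o : Option Bool)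
    (h : S flag = flagStack o) :
    (setFlag x).Runs S (Function.update S flag (flagStack (o.or (some x)))) 3 := by
  cases o with
  | none =>
    refine (Block.Runs.popCase_nil h (runs_pushConst flag (some x) _)).congr rfl ?_ le_rfl
    rw [h]; rfl
  | some y =>
    refine (Block.Runs.popCase_cons (x := some y) (l := []) h
      (runs_pushConst flag (some y) _)).congr rfl ?_ le_rfl
    simp [flagStack]

/-- Read one line and set the flag to `true` (`false`) if the candidate `row` (`col`) comes
first. -/
def scan : Prog :=
  .popLoop inp (fun x => x.isSome && decide (x ≠ some none)) fun x =>
    match x with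
    | none => .skip
    | some none => .push inp none
    | some (some true) =>
      ((Block.push line (some true)).seq (tick row row')).seq (tick col col')
    | some (some false) =>
      (Block.push line (some false)).seq
        ((settle row row' (setFlag true)).seq (settle col col' (setFlag false)))

theorem runs_scan_replicate {r l o n a : List (Option Bool)} {f : List (Option Bool)}
    {S : MatrixStack → List (Option Bool)} {t : ℕ} (c c' b i : ℕ)
    (h : scan.Runs (mk r (unary b ++ l) o (left c (i + b)) (moved c (i + b)) n
      (left c' (i + b)) (moved c' (i + b)) f a) S t) :
    scan.Runs (mk (unary b ++ r) l o (left c i) (moved c i) n (left c' i) (moved c' i) f a) S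
      (9 * b + t) := by
  induction b generalizing i l with
  | zero => simpa using h
  | succ b ih =>
    refine (Block.Runs.popLoop_again (x := some true) (l := unary b ++ r) rfl rfl
      (((runs_pushConst line (some true) _).seq (runs_tick (by decide) c i rfl rfl)).seq
        (runs_tick (by decide) c' i rfl rfl))
      ((ih (l := some true :: l) (i + 1) (h.congr ?_ rfl le_rfl)).congr (by simp [mk]) rfl
        le_rfl)).congr rfl rfl (by omega)
    rw [show i + 1 + b = i + (b + 1) by omega]
    simp [List.replicate_succ']

theorem moved_zero (c : ℕ) : moved c 0 = [] := by simp [moved]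

/-- Each unit of a name ticks both counters, and each separator settles both comparisons. A flag
that is set is never overwritten, so it remembers which candidate occurs first. The line is saved on
`line`, and its end mark is put back on `inp`. -/
theorem runs_scan (L : List ℕ) (B c c' : ℕ) (hL : ∀ b ∈ L, b ≤ B) (hc : c ≤ B) (hc' : c' ≤ B)
    (r l o n a : List (Option Bool)) (f : Option Bool) :
    scan.Runs (mk ((encodeNats L).map some ++ none :: r) l o (unary c) [] n (unary c') []
        (flagStack f) a)
      (mk (none :: r) (((encodeNats L).map some).reverse ++ l) o (unary c) [] n (unary c') []
        (flagStack (f.or (firstOf c c' L))) a)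
      ((encodeNats L).length * (6 * B + 25) + 3) := by
  induction L generalizing l f with
  | nil =>
    refine (Block.Runs.popLoop_exit (x := none) (l := r) rfl rfl
      (runs_pushConst inp none _)).congr rfl ?_ (by omega)
    simp [encodeNats, firstOf]
  | cons b L ih =>
    have hb : b ≤ B := hL b (by simp)
    have h₁ := runs_settle (k := row) (k' := row') (by decide) c b B hb hc
      (S := mk ((encodeNats L).map some ++ none :: r) (some false :: (unary b ++ l)) o
        (left c b) (moved c b) n (left c' b) (moved c' b) (flagStack f) a) rfl rfl
      (runs_setFlag true _ f rfl)
    have h₂ := fun f' => runs_settle (k := col) (k' := col') (by decide) c' b B hb hc'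
      (S := mk ((encodeNats L).map some ++ none :: r) (some false :: (unary b ++ l)) o
        (unary c) [] n (left c' b) (moved c' b) (flagStack f') a) rfl rfl
      (runs_setFlag false _ f' rfl)
    simp only [update_row, update_row', update_col, update_col', update_flag] at h₁ h₂
    have h₃ : ∃ S₁, S₁ = mk ((encodeNats L).map some ++ none :: r) (some false :: (unary b ++ l)) o
          (unary c) [] n (unary c') []
          (flagStack (f.or (if b = c then some true else if b = c' then some false else none))) a ∧
        ((settle row row' (setFlag true)).seq (settle col col' (setFlag false))).Runs
          (mk ((encodeNats L).map some ++ none :: r) (some false :: (unary b ++ l)) o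
            (left c b) (moved c b) n (left c' b) (moved c' b) (flagStack f) a) S₁
          (6 * B + 22) := by
      refine ⟨_, rfl, ?_⟩
      by_cases hbc : b = c
      · rw [if_pos hbc] at h₁ ⊢
        refine (h₁.seq (h₂ _)).congr rfl ?_ (by omega)
        -- If `c = c'`, the comparison with `row` has already set the flag and the one with `col`
        -- has no effect, in agreement with `firstOf`.
        by_cases hbc' : b = c'
        · rw [if_pos hbc']; cases f <;> rfl
        · rw [if_neg hbc']
      · rw [if_neg hbc] at h₁ ⊢
        refine (h₁.seq (h₂ _)).congr rfl ?_ (by omega)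
        by_cases hbc' : b = c'
        · rw [if_pos hbc', if_pos hbc']
        · rw [if_neg hbc', if_neg hbc']; cases f <;> rfl
    obtain ⟨_, rfl, h₃⟩ := h₃
    have h₄ := Block.Runs.popLoop_again (k := inp)
      (again := fun x => x.isSome && decide (x ≠ some none)) (x := some false)
      (l := (encodeNats L).map some ++ none :: r)
      (S := mk (some false :: ((encodeNats L).map some ++ none :: r)) (unary b ++ l) o
        (left c b) (moved c b) n (left c' b) (moved c' b) (flagStack f) a) rfl rfl
      ((runs_pushConst line (some false) _).seq (h₃.congr (by simp [mk]) rfl le_rfl))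
      (ih (fun b hb => hL b (by simp [hb])) (some false :: (unary b ++ l)) _)
    have h₅ := runs_scan_replicate
      (r := some false :: ((encodeNats L).map some ++ none :: r)) (l := l) (o := o) (n := n)
      (a := a) (f := flagStack f) c c' b 0 (h₄.congr (by rw [zero_add]) rfl le_rfl)
    refine h₅.congr ?_ ?_ ?_
    · simp [encodeNats, left, moved_zero]
    · have : ((f.or (if b = c then some true else if b = c' then some false else none)).or
          (firstOf c c' L)) = f.or (firstOf c c' (b :: L)) := by
        rw [firstOf]
        split_ifs <;> cases f <;> rfl
      rw [this]
      simp [encodeNats]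
    · have hlen : (encodeNats (b :: L)).length = b + 1 + (encodeNats L).length := by
        rw [encodeNats, List.flatMap_cons, ← encodeNats, List.length_append, List.length_append,
          List.length_replicate, List.length_singleton]
      rw [hlen, add_mul, add_mul]
      have : 9 * b ≤ b * (6 * B + 25) := by
        rw [mul_comm]; exact Nat.mul_le_mul_left b (by omega)
      omega

/-- Compare two candidates. -/
def compare : Prog :=
  (scan.seq (transfer line inp)).seq
    (.popCase flag fun x => .push acc (x.elim (some false) id))

/-- Moving `line` back to `inp` restores the ranking, so the same line can be scanned again for the
next pair. -/
theorem runs_compare (L : List ℕ) (B c c' : ℕ) (hL : ∀ b ∈ L, b ≤ B) (hc : c ≤ B) (hc' : c' ≤ B)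
    (r o n a : List (Option Bool)) :
    compare.Runs (mk ((encodeNats L).map some ++ none :: r) [] o (unary c) [] n (unary c') [] [] a)
      (mk ((encodeNats L).map some ++ none :: r) [] o (unary c) [] n (unary c') [] []
        (some ((firstOf c c' L).getD false) :: a))
      ((encodeNats L).length * (6 * B + 28) + 9) := by
  have h₁ := (runs_scan L B c c' hL hc hc' r [] o n a none).seq
    (runs_transfer (k := line) (k' := inp) (by decide) _)
  have h₂ : ∀ (i : List (Option Bool)) (f : Option Bool),
      (Block.popCase flag fun x => .push acc (x.elim (some false) id) : Prog).Runs
        (mk i [] o (unary c) [] n (unary c') [] (flagStack f) a)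
        (mk i [] o (unary c) [] n (unary c') [] [] (some (f.getD false) :: a)) 3 := by
    intro i f
    cases f with
    | none =>
      exact Block.Runs.popCase_nil rfl
        ((runs_pushConst acc _ _).congr rfl (by simp [flagStack]; rfl) le_rfl)
    | some f =>
      exact Block.Runs.popCase_cons (x := some f) (l := []) rfl
        ((runs_pushConst acc _ _).congr rfl (by simp; rfl) le_rfl)
  rw [compare]
  refine (h₁.seq ((h₂ _ _).congr ?_ rfl le_rfl)).congr rfl rfl ?_
  · simp [mk]
  · simp [mk]; ring_nf; omega

end MatrixStack

end StackMachine

/-! ### Writing the whole comparison matrix. -/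

open Turing

namespace StackMachine

open Crossing

namespace MatrixStack

/-- The comparisons of all pairs of candidates in a ranking of `m` candidates. -/
def comparisons (m : ℕ) (L : List ℕ) : List Bool :=
  (List.range m).flatMap fun c => (List.range m).map fun c' => (firstOf c c' L).getD false

theorem length_comparisons (m : ℕ) (L : List ℕ) : (comparisons m L).length = m * m := by
  simp [comparisons, List.length_flatMap]

/-- Remove the rest of the current line. -/
def dropLine : Prog :=
  .popLoop inp (fun x => x.isSome && decide (x ≠ some none)) fun _ => .skip

theorem runs_dropLine (w : List Bool) (r o n a : List (Option Bool)) :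
    dropLine.Runs (mk (w.map some ++ none :: r) [] o [] [] n [] [] [] a)
      (mk r [] o [] [] n [] [] [] a) (3 * w.length + 3) := by
  induction w with
  | nil =>
    exact (Block.Runs.popLoop_exit (x := none) (l := r) rfl rfl (Block.runs_skip _)).congr rfl
      (by simp) (by simp)
  | cons x w ih =>
    refine (Block.Runs.popLoop_again (x := some x) (l := w.map some ++ none :: r) rfl rfl
      (Block.runs_skip _) (ih.congr (by simp) rfl le_rfl)).congr rfl rfl ?_
    simp only [List.length_cons]
    omega

/-- Translate the rankings of the voters. -/
def rows : Prog :=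
  .forEach inp fun x =>
    (((Block.push inp x).seq (doubleLoop compare)).seq dropLine).seq (.push acc none)

/-- The symbol popped by the loop only signals that another line exists, and it is pushed back at
once. The line is then scanned for each of the `m * m` pairs before it is dropped. -/
theorem runs_rows (m B : ℕ) (Ls : List (List ℕ)) (hm : ∀ L ∈ Ls, ∀ b ∈ L, b ≤ m)
    (hB : ∀ L ∈ Ls, (encodeNats L).length ≤ B) (d : List (Option Bool)) :
    rows.Runs (mk (encodeLines (Ls.map encodeNats)) [] (unary m) [] [] (unary m) [] [] [] d)
      (mk [] [] (unary m) [] [] (unary m) [] [] []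
        ((encodeLines (Ls.map (comparisons m))).reverse ++ d))
      (Ls.length * (m * (m * (B * (6 * m + 28) + 15) + 9) + 3 * m + 3 * B + 13) + 3) := by
  induction Ls generalizing d with
  | nil => exact (Block.runs_forEach_nil _ rfl).congr rfl (by simp [encodeLines]) (by simp)
  | cons L Ls ih =>
    have hL := hB L (by simp)
    -- The ranking may be empty, in which case the first symbol `x` is the end mark of its line.
    obtain ⟨x, l, hx⟩ : ∃ x l, (encodeNats L).map some ++ none :: encodeLines (Ls.map encodeNats) =
        x :: l := by
      cases encodeNats L <;> simp
    have h₁ := runs_doubleLoop (B := compare) (m := m) (i := x :: l)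
      (t := B * (6 * m + 28) + 9) (fun c c' => (firstOf c c' L).getD false)
      (fun c c' y z d hc hc' => by
        rw [← hx]
        exact (runs_compare L m c c' (hm L (by simp)) hc.le hc'.le _ _ _ _).mono
          (by gcongr)) d
    have h₂ := runs_dropLine (encodeNats L) (encodeLines (Ls.map encodeNats)) (unary m) (unary m)
      (((comparisons m L).map some).reverse ++ d)
    rw [hx] at h₂
    refine (Block.Runs.forEach_cons (x := x) (l := l) (by rw [← hx, ← encodeLines_cons]; rfl)
      ((((runs_pushConst inp x _).seq (h₁.congr (by simp) rfl le_rfl)).seq h₂).seq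
        (runs_pushConst acc none _))
      ((ih (fun L hL => hm L (by simp [hL])) (fun L hL => hB L (by simp [hL]))
        (none :: (((comparisons m L).map some).reverse ++ d))).congr (by simp [mk]) rfl
          le_rfl)).congr rfl ?_ ?_
    · simp [encodeLines_cons]
    · rw [List.length_cons, add_mul, one_mul, show B * (6 * m + 28) + 9 + 6 =
        B * (6 * m + 28) + 15 from rfl]
      omega

/-- Read the number of candidates. -/
def header : Prog :=
  .popLoop inp (fun x => decide (x = some (some true))) fun x =>
    bif decide (x = some (some true)) then
      (Block.push outer (some true)).seq (Block.push inner (some true))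
    else .skip

theorem runs_header (m k : ℕ) (r : List (Option Bool)) :
    header.Runs (mk ((List.replicate m true).map some ++ none :: r) [] (unary k) [] [] (unary k)
        [] [] [] [])
      (mk r [] (unary (m + k)) [] [] (unary (m + k)) [] [] [] []) (4 * m + 3) := by
  induction m generalizing k with
  | zero =>
    exact (Block.Runs.popLoop_exit (x := none) (l := r) rfl rfl (Block.runs_skip _)).congr
      rfl (by simp) (by omega)
  | succ m ih =>
    refine (Block.Runs.popLoop_again (x := some true)
      (l := (List.replicate m true).map some ++ none :: r) rfl rfl
      ((runs_pushConst outer (some true) _).seq (runs_pushConst inner (some true) _))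
      ((ih (k + 1)).congr (by simp [mk, List.replicate_succ]) rfl le_rfl)).congr rfl ?_ (by omega)
    rw [show m + (k + 1) = m + 1 + k by omega]

/-- Write the comparison matrix of a profile. -/
def translate : Prog :=
  ((((((header.seq (doubleLoop (.push acc (some true)))).seq (.push acc none)).seq rows).seq
    (clear outer)).seq (clear inner)).seq (transfer acc inp))

theorem runs_translate (m B : ℕ) (Ls : List (List ℕ)) (hm : ∀ L ∈ Ls, ∀ b ∈ L, b ≤ m)
    (hB : ∀ L ∈ Ls, (encodeNats L).length ≤ B) :
    translate.Runs (single inp (encodeLines (List.replicate m true :: Ls.map encodeNats)))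
      (single inp (encodeLines (List.replicate (m * m) true :: Ls.map (comparisons m))))
      (Ls.length * (m * (m * (B * (6 * m + 28) + 15) + 9) + 3 * m + 3 * B + 13) + 3 +
        (m * (m * 7 + 9) + 13 * m) + 3 * ((Ls.length + 1) * (m * m + 1)) + 19) := by
  have h := runs_header m 0 (encodeLines (Ls.map encodeNats))
  -- With a constant body the double loop writes `m * m` units, the number of columns in the new
  -- first line.
  have h₁ := runs_doubleLoop (B := Block.push acc (some true)) (m := m)
    (i := encodeLines (Ls.map encodeNats)) (t := 1) (fun _ _ => true)
    (fun c c' y z d hc hc' => (runs_pushConst acc (some true) _).congr rfl (by simp; rfl) le_rfl) []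
  have hrep : ((List.range m).flatMap fun _ => (List.range m).map fun _ => true) =
      List.replicate (m * m) true := by
    rw [List.eq_replicate_iff]
    simp [List.length_flatMap]
  rw [hrep] at h₁
  rw [translate]
  refine ((((((h.seq h₁).seq (runs_pushConst acc none _)).seq
    ((runs_rows m B Ls hm hB (none :: ((List.replicate (m * m) true).map some).reverse)).congr
      (by simp [mk]) rfl le_rfl)).seq
    (runs_clear outer _)).seq (runs_clear inner _)).seq
    (runs_transfer (k := acc) (k' := inp) (by decide) _)).congr ?_ ?_ ?_
  · simp [single_inp, encodeLines_cons]
  · simp [single_inp, mk, encodeLines_cons]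
  · have := length_encodeLines (Ls.map (comparisons m)) (m * m) (by
      simp only [List.mem_map]
      rintro _ ⟨L, -, rfl⟩
      exact length_comparisons m L)
    simp only [update_outer, update_inner, mk, List.length_append,
      List.length_reverse, List.length_cons, List.length_map, List.length_replicate, this]
    ring_nf
    omega

end MatrixStack

end StackMachine

/-! ### Crossings of a profile are switches of its comparison matrix. -/

namespace Crossing

open StackMachine

theorem firstOf_eq {m : ℕ} {R : Fin m → Fin m → Prop} (hR : ∀ c c', R c c' → ¬R c' c)
    {l : List (Fin m)} (hl : l.Pairwise R) {c c' : Fin m} (hc : c ∈ l) (hc' : c' ∈ l)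
    (hne : c ≠ c') : ((firstOf c c' (l.map Fin.val)).getD false = true) = R c c' := by
  induction l with
  | nil => simp at hc
  | cons b l ih =>
    rw [List.pairwise_cons] at hl
    rw [List.map_cons, firstOf]
    by_cases hb : b = c
    · subst hb
      have := hl.1 c' ((List.mem_cons.1 hc').resolve_left hne.symm)
      simp [this]
    · rw [if_neg fun h => hb (Fin.ext h)]
      by_cases hb' : b = c'
      · subst hb'
        have := hR _ _ (hl.1 c ((List.mem_cons.1 hc).resolve_left hne))
        simp [this]
      · rw [if_neg fun h => hb' (Fin.ext h)]
        exact ih hl.2 ((List.mem_cons.1 hc).resolve_left (Ne.symm hb))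
          ((List.mem_cons.1 hc').resolve_left (Ne.symm hb'))

/-- This makes the diagonal columns of the comparison matrix constant. -/
theorem firstOf_self {c : ℕ} {l : List ℕ} (hc : c ∈ l) : firstOf c c l = some true := by
  induction l with
  | nil => simp at hc
  | cons b l ih =>
    rw [firstOf]
    split_ifs with h
    · rfl
    · exact ih ((List.mem_cons.1 hc).resolve_left (Ne.symm h))

theorem Profile.mem_ranking {V : Type} {m : ℕ} (P : Profile V (Fin m)) (v : V) (c : Fin m) :
    c ∈ P.ranking v :=
  (P.ranking_perm v).mem_iff.2 (List.mem_finRange c)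

/-- The comparison matrix of a profile: the columns are the pairs of candidates, and an entry is
one if the voter prefers the first candidate of the pair. -/
noncomputable def profileToMatrix (x : (n : ℕ) × (m : ℕ) × Profile (Fin n) (Fin m)) :
    (n : ℕ) × (m : ℕ) × Matrix (Fin n) (Fin m) Bool :=
  ⟨x.1, x.2.1 * x.2.1, fun i j =>
    (firstOf j.divNat j.modNat ((x.2.2.ranking i).map Fin.val)).getD false⟩

/-- The column of a pair of distinct candidates is the sequence of its comparisons, and a diagonal
column has no switch. So the same order of the voters works on both sides. -/
theorem isCrossing_iff (k : ℕ) (x : (n : ℕ) × (m : ℕ) × Profile (Fin n) (Fin m)) :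
    IsCrossing k x.2.2 ↔ IsSwitchC1P k (profileToMatrix x).2.2 := by
  obtain ⟨n, m, P⟩ := x
  have htrue : Function.Injective fun b : Bool => b = true := by
    intro a b h; cases a <;> cases b <;> simp_all
  have key : ∀ (v : Fin n) (c c' : Fin m), c ≠ c' →
      ((firstOf c c' ((P.ranking v).map Fin.val)).getD false = true) = P.pref v c c' := by
    intro v c c' hne
    have := P.strictTotal v
    exact firstOf_eq (fun _ _ => asymm_of (P.pref v)) (P.ranking_pairwise v) (P.mem_ranking v c)
      (P.mem_ranking v c') hne
  refine exists_congr fun σ => ⟨fun h j => ?_, fun h c c' hne => ?_⟩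
  · rw [← numChanges_comp htrue]
    by_cases hj : j.divNat = j.modNat
    · have : ∀ v, ((profileToMatrix ⟨n, m, P⟩).2.2 v j = true) = True := by
        intro v
        simp only [profileToMatrix, hj]
        rw [firstOf_self (List.mem_map_of_mem (P.mem_ranking v j.modNat))]
        simp
      simp [this, numChanges_const]
    · have := h _ _ hj
      simp only [← key _ _ _ hj] at this
      exact this
  · have := h (finProdFinEquiv (c, c'))
    rw [← numChanges_comp htrue] at this
    have hd : (finProdFinEquiv (c, c')).divNat = c :=
      congrArg Prod.fst (finProdFinEquiv.symm_apply_apply (c, c'))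
    have hm : (finProdFinEquiv (c, c')).modNat = c' :=
      congrArg Prod.snd (finProdFinEquiv.symm_apply_apply (c, c'))
    simp only [profileToMatrix, hd, hm, key _ _ _ hne] at this
    exact this

theorem ofFn_val {α : Type} (m : ℕ) (f : ℕ → α) :
    (List.ofFn fun j : Fin m => f j) = (List.range m).map f := by
  rw [List.ofFn_eq_map, ← List.map_coe_finRange_eq_range, List.map_map]
  rfl

theorem encodeMatrix_profileToMatrix (x : (n : ℕ) × (m : ℕ) × Profile (Fin n) (Fin m)) :
    encodeMatrix (profileToMatrix x) = encodeLines (List.replicate (x.2.1 * x.2.1) true ::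
      (List.ofFn fun v : Fin x.1 => (x.2.2.ranking v).map Fin.val).map
        (MatrixStack.comparisons x.2.1)) := by
  obtain ⟨n, m, P⟩ := x
  have key : ∀ L : List ℕ, (List.ofFn fun j : Fin (m * m) =>
      (firstOf j.divNat j.modNat L).getD false) = MatrixStack.comparisons m L := by
    intro L
    -- Column `i * m + j` belongs to the pair `(i, j)`, so the row splits into `m` blocks in the
    -- order of the double loop.
    rw [List.ofFn_mul, MatrixStack.comparisons, List.flatMap_def, ← ofFn_val]
    congr 2
    funext i
    rw [← ofFn_val]
    congr 1
    funext j
    have hj : (j : ℕ) / m = 0 := Nat.div_eq_of_lt j.2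
    have hm : 0 < m := j.pos
    simp only [Fin.coe_divNat, Fin.coe_modNat]
    rw [Nat.mul_add_mod_of_lt j.2, mul_comm, Nat.mul_add_div hm, hj, add_zero]
  simp only [encodeMatrix, profileToMatrix, key, List.map_ofFn]
  rfl

end Crossing

/-! ### The comparison matrix in polynomial time, and the two reductions. -/

namespace StackMachine

open Crossing

theorem length_le_length_encodeLines {l : List Bool} {Ls : List (List Bool)} (h : l ∈ Ls) :
    l.length ≤ (encodeLines Ls).length := by
  induction Ls with
  | nil => simp at h
  | cons w Ls ih =>
    rw [encodeLines_cons, List.length_append, List.length_cons, List.length_map]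
    rcases List.mem_cons.1 h with rfl | h
    · omega
    · have := ih h
      omega

theorem length_le_encodeLines (Ls : List (List Bool)) : Ls.length ≤ (encodeLines Ls).length := by
  induction Ls with
  | nil => simp
  | cons w Ls ih =>
    rw [encodeLines_cons, List.length_append, List.length_cons, List.length_cons]
    omega

theorem computable_profileToMatrix :
    Nonempty (TM2ComputableInPolyTime encodeProfile encodeMatrix profileToMatrix) := by
  refine computable_of_runs (Γ := fun _ => Option Bool) (k₀ := MatrixStack.inp)
    (k₁ := MatrixStack.inp) MatrixStack.translate (.refl _) (.refl _)
    -- The numbers of voters and of candidates and the length of each line are at most the input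
    -- length `N`. There are at most `N` voters, `N ^ 2` pairs for each, and a comparison costs of
    -- order `N ^ 2`, which gives degree five.
    (100 * (Polynomial.X + 1) ^ 5) ?_
  rintro ⟨n, m, P⟩
  set Ls := List.ofFn fun v : Fin n => (P.ranking v).map Fin.val with hLs
  have henc : encodeProfile ⟨n, m, P⟩ =
      encodeLines (List.replicate m true :: Ls.map encodeNats) := by
    simp only [encodeProfile, hLs, List.map_ofFn]
    rfl
  rw [encodeMatrix_profileToMatrix, henc]
  set N := (encodeLines (List.replicate m true :: Ls.map encodeNats)).length with hN
  have hmN : m ≤ N := by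
    simpa using length_le_length_encodeLines (l := List.replicate m true)
      (Ls := List.replicate m true :: Ls.map encodeNats) (by simp)
  have hnN : Ls.length ≤ N := by
    have := length_le_encodeLines (List.replicate m true :: Ls.map encodeNats)
    simp only [List.length_cons, List.length_map] at this
    omega
  refine (MatrixStack.runs_translate m N Ls ?_ ?_).congr ?_ ?_ ?_
  · simp only [hLs, List.mem_ofFn]
    rintro _ ⟨v, rfl⟩ b hb
    obtain ⟨c, -, rfl⟩ := List.mem_map.1 hb
    exact c.2.le
  · intro L hL
    exact length_le_length_encodeLines (by simp; exact Or.inr ⟨L, hL, rfl⟩)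
  · simp
  · simp [hLs]
  · simp only [Polynomial.eval_mul, Polynomial.eval_ofNat, Polynomial.eval_pow,
      Polynomial.eval_add, Polynomial.eval_X, Polynomial.eval_one]
    calc _ ≤ N * (N * (N * (N * (6 * N + 28) + 15) + 9) + 3 * N + 3 * N + 13) + 3 +
          (N * (N * 7 + 9) + 13 * N) + 3 * ((N + 1) * (N * N + 1)) + 19 := by gcongr
      _ ≤ 100 * (N + 1) ^ 5 := by ring_nf; omega

theorem isPolyTimeReduction_profileToMatrix (k : ℕ) :
    IsPolyTimeReduction (crossingRec k) (switchC1PRec k) profileToMatrix :=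
  ⟨computable_profileToMatrix, isCrossing_iff k⟩

theorem isPolyTimeReduction_matrixToProfile (k : ℕ) :
    IsPolyTimeReduction (switchC1PRec k) (crossingRec k) matrixToProfile :=
  ⟨computable_matrixToProfile, isSwitchC1P_iff k⟩

end StackMachine

theorem mainTheorem8 :
    (Crossing.SwitchC1PConjecture →
      ∀ k : ℕ, 4 ≤ k → Crossing.NPComplete (Crossing.crossingRec k)) ∧
    (∀ k : ℕ, Crossing.IsPolyTimeReduction (Crossing.switchC1PRec k) (Crossing.crossingRec k)
      Crossing.matrixToProfile) ∧
    (∀ (k n m : ℕ) (M : Matrix (Fin n) (Fin m) Bool) (σ : Equiv.Perm (Fin n)),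
      Crossing.IsSwitchC1PWrt k M σ ↔ Crossing.IsCrossingWrt k (Crossing.matrixProfile M) σ) := by
  refine ⟨fun h k hk => ⟨?_, ?_⟩, StackMachine.isPolyTimeReduction_matrixToProfile,
    fun k _ _ => Crossing.isSwitchC1PWrt_iff k⟩
  -- Membership comes from the NP half of the hypothesis for the same `k`, pulled back along the
  -- comparison matrix; hardness is pushed forward along `M ↦ P_M`.
  · exact StackMachine.InNP.of_reduction (StackMachine.isPolyTimeReduction_profileToMatrix k)
      (h k hk).1
  · exact StackMachine.NPHard.of_reduction (h k hk).2
      (StackMachine.isPolyTimeReduction_matrixToProfile k)
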